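/- **Setting.** A quadrilateral lattice is a finite graph $Q\subset\mathbb C$ with straight-line edges, meeting only at common endpoints, such that every bounded face is a (not necessarily convex) quadrilateral $z_1z_2z_3z_4$, the boundary $\partial Q$ of the outer face is a closed curve without self-intersections, and any two distinct bounded faces (with their sides) are disjoint or share exactly one vertex or exactly one edge. Let $Q^0$ be the set of vertices, and let $h$ be twice the maximal edge length. The eccentricity $e$ of $Q$ is the infimum of the numbers $K$ such that * in each face the ratio of the two diagonals (in either order) is less than $K$ and the angle between them is greater than $1/K$; * each disk of radius equal to the maximal edge length contains fewer than $K$ vertices. Joining opposite vertices of each face yields two graphs; let $B$ be one of them and $B^0\subset Q^0$ its vertex set (so in each face one pair of opposite vertices lies in $B^0$ and the other pair does not). For $u\colon Q^0\to\mathbb R$, the gradient $\nabla_Q u$ at a face $z_1z_2z_3z_4$ is the vector with $\nabla_Qu\cdot\overrightarrow{z_1z_3}=u(z_3)-u(z_1)$ and $\nabla_Qu\cdot\overrightarrow{z_2z_4}=u(z_4)-u(z_2)$; the energy is $E_Q(u)=\sum|\nabla_Qu|^2\,\mathrm{Area}(z_1z_2z_3z_4)$ over all bounded faces; and the laplacian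 is $[\Delta_Qu](z)=-\partial E_Q(u)/\partial u(z)$. For a smooth function $g\colon\mathbb C\to\mathbb R$ put $|D^kg(z)|=\max_{0\le j\le k}\left|\frac{\partial^kg}{\partial x^j\partial y^{k-j}}(z)\right|$. **Laplacian Approximation Lemma.** For every $e$ there is a constant $C_e>0$ depending only on $e$ such that the following holds. Let $Q$ be a quadrilateral lattice of eccentricity $e$, let $R$ be a closed square (with sides of any direction) of side length $r>h$ contained in the open region enclosed by $\partial Q$, let $R_h$ be the closed $h$-neighbourhood of $R$, and let $g\colon\mathbb C\to\mathbb R$ be smooth. Then $$\left|\sum_{z\in R\cap B^0}[\Delta_Q(g|_{Q^0})](z)-\int_R\Delta g\,dx\,dy\right|\le C_e\left(hr\max_{z\in R}|D^2g(z)|+r^3\max_{z\in R_h}|D^3g(z)|\right).$$ -/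

import Mathlib

open scoped ContDiff

noncomputable section

/-- A finite graph in the complex plane with rectilinear edges: the edge `ab` is drawn as the
segment `[a, b]`, an edge passes through no vertex except its ends, and two distinct edges meet
at most in a common end. -/
structure PlaneGraph where
  /-- the set `Q⁰` of vertices -/
  verts : Finset ℂ
  graph : SimpleGraph ℂ
  mem_verts : ∀ a b, graph.Adj a b → a ∈ verts
  vert_edge : ∀ a b v, graph.Adj a b → v ∈ verts → v ∈ segment ℝ a b → v = a ∨ v = b
  edge_edge : ∀ a b c d, graph.Adj a b → graph.Adj c d → s(a, b) ≠ s(c, d) →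
    segment ℝ a b ∩ segment ℝ c d ⊆ {a, b} ∩ {c, d}

namespace PlaneGraph

variable (Q : PlaneGraph)

/-- The subset of the plane occupied by the graph. -/
def support : Set ℂ := {z | z ∈ Q.verts ∨ ∃ a b, Q.graph.Adj a b ∧ z ∈ segment ℝ a b}

/-- The bounded faces: the bounded connected components of the complement of the graph
(these are open sets; `closure F` is the face together with its sides). -/
def faces : Set (Set ℂ) :=
  {F | Bornology.IsBounded F ∧ ∃ z ∈ Q.supportᶜ, F = connectedComponentIn Q.supportᶜ z}

/-- The outer face: the unbounded connected component of the complement of the graph. -/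
def outerFace : Set ℂ :=
  {z | z ∈ Q.supportᶜ ∧ ¬ Bornology.IsBounded (connectedComponentIn Q.supportᶜ z)}

/-- The boundary `∂Q`: the boundary of the outer face. -/
def boundary : Set ℂ := frontier Q.outerFace

/-- The open region enclosed by `∂Q` (the points neither in the outer face nor on `∂Q`). -/
def inside : Set ℂ := (Q.outerFace ∪ Q.boundary)ᶜ

/-- `F` is a quadrilateral with consecutive vertices `z 0, z 1, z 2, z 3`: these are distinct,
the sides are edges of the graph, and the boundary of `F` is the closed broken line
through them. The quadrilateral need not be convex. -/
structure IsQuadrilateral (F : Set ℂ) (z : Fin 4 → ℂ) : Prop where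
  injective : Function.Injective z
  adj : ∀ i, Q.graph.Adj (z i) (z (i + 1))
  frontier_eq : frontier F = ⋃ i, segment ℝ (z i) (z (i + 1))

/-- The maximal edge length. -/
def maxEdge : ℝ := sSup {l | ∃ a b, Q.graph.Adj a b ∧ l = dist a b}

/-- `h`: twice the maximal edge length. -/
def h : ℝ := 2 * Q.maxEdge

/-- The vertices of a quadrilateral face, listed around the face. Nothing below depends on which
of the (up to eight) listings is chosen. -/
def corner (F : Set ℂ) : Fin 4 → ℂ := Classical.epsilon (Q.IsQuadrilateral F)

/-- The diagonal `z₁z₃` of a face, as a vector. -/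
def diag₁ (F : Set ℂ) : ℂ := Q.corner F 2 - Q.corner F 0

/-- The diagonal `z₂z₄` of a face, as a vector. -/
def diag₂ (F : Set ℂ) : ℂ := Q.corner F 3 - Q.corner F 1

/-- `v` is the discrete gradient of `u` at the face `F`. -/
def IsGradient (u : ℂ → ℝ) (F : Set ℂ) (v : ℂ) : Prop :=
  inner ℝ v (Q.diag₁ F) = u (Q.corner F 2) - u (Q.corner F 0) ∧
  inner ℝ v (Q.diag₂ F) = u (Q.corner F 3) - u (Q.corner F 1)

/-- The discrete gradient `∇_Q u` at a face: the vector singled out by `IsGradient` (it exists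
and is unique, the diagonals of a quadrilateral being linearly independent). Here and below only
the values of `u` at the vertices matter, so that `u` stands for its restriction to `Q⁰`. -/
def grad (u : ℂ → ℝ) (F : Set ℂ) : ℂ := Classical.epsilon (Q.IsGradient u F)

/-- The discrete energy `E_Q(u) = ∑ |∇_Q u|² Area`, the sum being over all (bounded) faces. -/
def energy (u : ℂ → ℝ) : ℝ :=
  ∑ᶠ F ∈ Q.faces, ‖Q.grad u F‖ ^ 2 * (MeasureTheory.volume F).toReal

/-- The discrete laplacian `[Δ_Q u](z) = -∂E_Q(u)/∂u(z)`. -/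
def laplacian (u : ℂ → ℝ) (z : ℂ) : ℝ :=
  -deriv (fun t : ℝ => Q.energy (Function.update u z t)) (u z)

/-- Condition (D): for each face the ratio of the diagonals (in either order) is less than `K`,
and the angle between them (as lines) is greater than `1 / K`. -/
def CondD (K : ℝ) : Prop :=
  ∀ F ∈ Q.faces,
    ‖Q.diag₁ F‖ / ‖Q.diag₂ F‖ < K ∧ ‖Q.diag₂ F‖ / ‖Q.diag₁ F‖ < K ∧
    1 / K < InnerProductGeometry.angle (Q.diag₁ F) (Q.diag₂ F) ∧
    1 / K < Real.pi - InnerProductGeometry.angle (Q.diag₁ F) (Q.diag₂ F)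

/-- Condition (U): each disk of radius equal to the maximal edge length contains less than `K`
vertices. -/
def CondU (K : ℝ) : Prop :=
  ∀ c : ℂ, (((Q.verts : Set ℂ) ∩ Metric.closedBall c Q.maxEdge).ncard : ℝ) < K

/-- The eccentricity `e`. -/
def eccentricity : ℝ := sInf {K | Q.CondD K ∧ Q.CondU K}

/-- `B` is the set of vertices of one of the two graphs obtained by joining the opposite vertices
of each face: in each face, one pair of opposite vertices belongs to `B` and the other pair to
its complement. -/
def IsColorClass (B : Finset ℂ) : Prop :=
  B ⊆ Q.verts ∧ ∀ F ∈ Q.faces,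
    (Q.corner F 0 ∈ B ∧ Q.corner F 2 ∈ B ∧ Q.corner F 1 ∉ B ∧ Q.corner F 3 ∉ B) ∨
    (Q.corner F 1 ∈ B ∧ Q.corner F 3 ∈ B ∧ Q.corner F 0 ∉ B ∧ Q.corner F 2 ∉ B)

end PlaneGraph

/-- A quadrilateral lattice: each bounded face is a quadrilateral, the boundary `∂Q` is a closed
curve without self-intersections, and two distinct (bounded) faces are disjoint or share exactly
a vertex or exactly an edge. -/
structure QuadLattice extends PlaneGraph where
  quad : ∀ F ∈ toPlaneGraph.faces, ∃ z, toPlaneGraph.IsQuadrilateral F z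
  boundary_curve : ∃ γ : Circle → ℂ,
    Continuous γ ∧ Function.Injective γ ∧ Set.range γ = toPlaneGraph.boundary
  face_face : ∀ F ∈ toPlaneGraph.faces, ∀ G ∈ toPlaneGraph.faces, F ≠ G →
    closure F ∩ closure G = ∅ ∨
    (∃ v ∈ verts, closure F ∩ closure G = {v}) ∨
    (∃ a b, graph.Adj a b ∧ closure F ∩ closure G = segment ℝ a b)

/-- The closed square with center `c`, side length `r` and a side parallel to the unit
vector `d`. -/
def closedSquare (c d : ℂ) (r : ℝ) : Set ℂ :=
  {z | |((z - c) * (starRingEnd ℂ) d).re| ≤ r / 2 ∧ |((z - c) * (starRingEnd ℂ) d).im| ≤ r / 2}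

/-- `|Dᵏg(z)|`: the maximum over `0 ≤ j ≤ k` of the absolute value of the partial derivative of
`g` at `z` taken `j` times in `x` and `k - j` times in `y`. -/
def absD (k : ℕ) (g : ℂ → ℝ) (z : ℂ) : ℝ :=
  ⨆ j : Fin (k + 1),
    |iteratedFDeriv ℝ k g z (fun i : Fin k => if (i : ℕ) < (j : ℕ) then 1 else Complex.I)|

end

/-! The proof is a discrete Gauss theorem. Let `χ` be the indicator of `R ∩ B⁰`. The energy is
quadratic, so the laplacian summed over `R ∩ B⁰` is minus the sum over faces, with orientation
signs, of the inner product of `∇_Q g` with a vector `N_F`. This `N_F` is the sum over the sides of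
`χ(zᵢ) + χ(zᵢ₊₁)` times the rotated side (`sum_laplacian`, `conormal_eq_sum`).

Replace `∇_Q g` on each side by the value at its midpoint of one fixed affine field `W`. An edge
then contributes opposite amounts to its two faces, and every edge that matters has an end in `R`,
hence a face on either side. So the replaced sum vanishes (`sum_side_eq_zero`) and may be subtracted
for free.

After the subtraction there are three kinds of faces. Those with no `B`-vertex in `R` contribute
nothing. Those with all `B`-vertices in `R` have `N_F = 0` and weight 1 on every side, so they leave
exactly the flux of `W`, that is divergence times area (`sum_flux`); they fill `R` up to area
`O(hr)` (`abs_area_sub_le`). The others cross the boundary of `R`. The eccentricity allows `O(r/h)`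
of them (`card_crossing_le`), and each costs `O(h(m + Mh))`, where `M` bounds the coefficients of
`W` and `m` its distance from `∇g` (`norm_grad_sub_le`, `face_error`).

For `W` take the gradient of the second Taylor polynomial of `g` at the centre of `R`: then `m` is
of order `r²|D³g|`, `M` is at most the maximum of `|D²g|` on `R`, and the divergence is `Δg` at the
centre.

The geometric input is that a face, known only as a component of the complement of the graph, has
the area given by its diagonals and lies on the expected side of each of its edges
(`exists_isOriented`). -/

noncomputable section

section

open MeasureTheory Set Filter Topology

/-! ### Signed areas and triangles in the plane. -/

/-- The oriented area of the parallelogram spanned by two vectors of the plane. -/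
def cross (a b : ℂ) : ℝ := a.re * b.im - a.im * b.re

/-- Twice the signed area of the triangle `abp`. -/
def ori (a b p : ℂ) : ℝ := cross (b - a) (p - a)

lemma ori_self_left (a b : ℂ) : ori a b a = 0 := by simp [ori, cross]
lemma ori_self_right (a b : ℂ) : ori a b b = 0 := by simp [ori, cross]; ring
lemma ori_rotate (a b c : ℂ) : ori b c a = ori a b c := by simp [ori, cross]; ring
lemma ori_swap (a b c : ℂ) : ori b a c = -ori a b c := by simp [ori, cross]; ring

lemma ori_combo (a b p q : ℂ) (s t : ℝ) (h : s + t = 1) :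
    ori a b (s • p + t • q) = s * ori a b p + t * ori a b q := by
  obtain rfl : s = 1 - t := by linarith
  simp [ori, cross]; ring

lemma convex_ori_nonneg (a b : ℂ) : Convex ℝ {p | 0 ≤ ori a b p} := by
  intro p hp q hq s t hs ht hst
  simp only [mem_ofPred_eq] at *
  rw [ori_combo _ _ _ _ _ _ hst]; positivity

lemma convex_ori_pos (a b : ℂ) : Convex ℝ {p | 0 < ori a b p} := by
  intro p hp q hq s t hs ht hst
  simp only [mem_ofPred_eq] at *
  rw [ori_combo _ _ _ _ _ _ hst]
  rcases hs.eq_or_lt with rfl | hs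
  · have : t = 1 := by linarith
    subst this; simpa using hq
  · have : 0 ≤ t * ori a b q := by positivity
    have : 0 < s * ori a b p := by positivity
    linarith

lemma ori_eq_zero_of_mem_segment {a b p : ℂ} (h : p ∈ segment ℝ a b) : ori a b p = 0 := by
  obtain ⟨s, t, _, _, hst, rfl⟩ := h
  rw [ori_combo _ _ _ _ _ _ hst, ori_self_left, ori_self_right]; simp

/-- A small move to the right of `ab` stays in `S` but lowers `ori a b` strictly, so `ori a b p`
cannot be zero. -/
lemma interior_subset_ori_pos {a b : ℂ} (hab : a ≠ b) {S : Set ℂ}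
    (hS : ∀ p ∈ S, 0 ≤ ori a b p) {p : ℂ} (hp : p ∈ interior S) : 0 < ori a b p := by
  have hc : Continuous fun t : ℝ => p - (t : ℂ) * (Complex.I * (b - a)) := by fun_prop
  have h0 : ∀ᶠ t : ℝ in 𝓝 0, p - (t : ℂ) * (Complex.I * (b - a)) ∈ S := by
    apply hc.continuousAt.eventually_mem
    simpa using mem_interior_iff_mem_nhds.1 hp
  obtain ⟨t, ht, ht0⟩ := ((h0.filter_mono nhdsWithin_le_nhds).and
    (self_mem_nhdsWithin (s := Ioi (0 : ℝ)))).exists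
  have h1 := hS _ ht
  have h2 : ori a b (p - (t : ℂ) * (Complex.I * (b - a))) =
      ori a b p - t * Complex.normSq (b - a) := by
    simp [ori, cross, Complex.normSq_apply]; ring
  have h3 : 0 < Complex.normSq (b - a) := Complex.normSq_pos.2 (sub_ne_zero.2 hab.symm)
  have := mul_pos ht0 h3
  linarith

/-- The standard triangle with vertices `0, 1, i`. -/
def stdTriangle : Set ℂ := {z | 0 ≤ z.re ∧ 0 ≤ z.im ∧ z.re + z.im ≤ 1}

lemma convex_stdTriangle : Convex ℝ stdTriangle := by
  rintro p ⟨h1, h2, h3⟩ q ⟨h4, h5, h6⟩ s t hs ht hst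
  refine ⟨?_, ?_, ?_⟩ <;> simp
  · positivity
  · positivity
  · nlinarith

lemma isClosed_stdTriangle : IsClosed stdTriangle := by
  refine (isClosed_le continuous_const Complex.continuous_re).inter
    ((isClosed_le continuous_const Complex.continuous_im).inter
      (isClosed_le (Complex.continuous_re.add Complex.continuous_im) continuous_const))

lemma isCompact_stdTriangle : IsCompact stdTriangle := by
  refine Metric.isCompact_of_isClosed_isBounded isClosed_stdTriangle
    ((Metric.isBounded_closedBall (x := (0 : ℂ)) (r := 1)).subset ?_)
  rintro z ⟨h1, h2, h3⟩
  have := Complex.norm_le_abs_re_add_abs_im z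
  rw [abs_of_nonneg h1, abs_of_nonneg h2] at this
  simpa using this.trans h3

lemma volume_stdTriangle : volume stdTriangle = ENNReal.ofReal (1 / 2) := by
  rw [← Complex.volume_preserving_equiv_real_prod.symm.measure_preimage
    isClosed_stdTriangle.measurableSet.nullMeasurableSet, Measure.volume_eq_prod,
    Measure.prod_apply (Complex.measurableEquivRealProd.symm.measurable
      isClosed_stdTriangle.measurableSet)]
  have h : ∀ x : ℝ, volume (Prod.mk x ⁻¹' (Complex.measurableEquivRealProd.symm ⁻¹' stdTriangle))
      = (Icc (0 : ℝ) 1).indicator (fun x => ENNReal.ofReal (1 - x)) x := by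
    intro x
    have : Prod.mk x ⁻¹' (Complex.measurableEquivRealProd.symm ⁻¹' stdTriangle) =
        {y : ℝ | 0 ≤ x ∧ 0 ≤ y ∧ x + y ≤ 1} := by
      ext y; simp [stdTriangle, Complex.measurableEquivRealProd]
    rw [this]
    by_cases hx : x ∈ Icc (0 : ℝ) 1
    · rw [indicator_of_mem hx]
      have : {y : ℝ | 0 ≤ x ∧ 0 ≤ y ∧ x + y ≤ 1} = Icc 0 (1 - x) := by
        ext y; simp [hx.1, le_sub_iff_add_le, add_comm]
      rw [this, Real.volume_Icc, sub_zero]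
    · rw [indicator_of_notMem hx]
      have : {y : ℝ | 0 ≤ x ∧ 0 ≤ y ∧ x + y ≤ 1} = ∅ := by
        ext y; simp only [mem_ofPred_eq, mem_empty_iff_false, iff_false]
        rintro ⟨h1, h2, h3⟩; exact hx ⟨h1, by linarith⟩
      rw [this, measure_empty]
  simp_rw [h]
  rw [lintegral_indicator measurableSet_Icc, ← ofReal_integral_eq_lintegral_ofReal]
  · rw [integral_Icc_eq_integral_Ioc, ← intervalIntegral.integral_of_le zero_le_one]
    congr 1
    rw [intervalIntegral.integral_sub (by simp) (by simp)]
    simp; norm_num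
  · exact (by fun_prop : Continuous fun x : ℝ => 1 - x).integrableOn_Icc
  · filter_upwards [ae_restrict_mem measurableSet_Icc] with x hx
    simpa using hx.2

/-- The real linear map taking `1, i` to `u, v`. -/
def frameMap (u v : ℂ) : ℂ →L[ℝ] ℂ :=
  Complex.reCLM.smulRight u + Complex.imCLM.smulRight v

lemma frameMap_apply (u v z : ℂ) : frameMap u v z = z.re • u + z.im • v := rfl

lemma det_frameMap (u v : ℂ) : (frameMap u v).det = cross u v := by
  rw [ContinuousLinearMap.det, ← LinearMap.det_toMatrix Complex.basisOneI, Matrix.det_fin_two]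
  simp [LinearMap.toMatrix_apply, frameMap_apply, cross]
  ring

/-- The closed (possibly degenerate) triangle with vertices `a, b, c`. -/
def triangle (a b c : ℂ) : Set ℂ := (fun z => a + frameMap (b - a) (c - a) z) '' stdTriangle

lemma isCompact_triangle (a b c : ℂ) : IsCompact (triangle a b c) :=
  isCompact_stdTriangle.image (by fun_prop)

lemma isClosed_triangle (a b c : ℂ) : IsClosed (triangle a b c) := (isCompact_triangle a b c).isClosed

lemma convex_triangle (a b c : ℂ) : Convex ℝ (triangle a b c) := by
  have : triangle a b c = (fun z => a + z) '' ((frameMap (b - a) (c - a)) '' stdTriangle) := by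
    rw [image_image]; rfl
  rw [this]
  exact (convex_stdTriangle.is_linear_image (frameMap (b - a) (c - a)).toLinearMap.isLinear).translate a

lemma volume_triangle (a b c : ℂ) :
    volume (triangle a b c) = ENNReal.ofReal (|ori a b c| / 2) := by
  have : triangle a b c = (fun z => a + z) '' ((frameMap (b - a) (c - a)) '' stdTriangle) := by
    rw [image_image]; rfl
  rw [this, image_add_left, measure_preimage_add, Measure.addHaar_image_continuousLinearMap,
    ← ContinuousLinearMap.det, det_frameMap, volume_stdTriangle, ← ENNReal.ofReal_mul (abs_nonneg _), ori, mul_one_div]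

lemma left_mem_triangle (a b c : ℂ) : a ∈ triangle a b c := ⟨0, by simp [stdTriangle], by simp⟩
lemma mid_mem_triangle (a b c : ℂ) : b ∈ triangle a b c :=
  ⟨1, by simp [stdTriangle], by simp [frameMap_apply]⟩
lemma right_mem_triangle (a b c : ℂ) : c ∈ triangle a b c :=
  ⟨Complex.I, by simp [stdTriangle], by simp [frameMap_apply]⟩

lemma triangle_subset {a b c : ℂ} {S : Set ℂ} (hS : Convex ℝ S) (ha : a ∈ S) (hb : b ∈ S)
    (hc : c ∈ S) : triangle a b c ⊆ S := by
  rintro _ ⟨z, ⟨h1, h2, h3⟩, rfl⟩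
  have h := hS.sum_mem (t := Finset.univ) (w := ![1 - z.re - z.im, z.re, z.im]) (z := ![a, b, c])
    (by intro i _; fin_cases i <;> simp <;> linarith) (by simp [Fin.sum_univ_three]; ring)
    (by intro i _; fin_cases i <;> simp [ha, hb, hc])
  convert h using 1
  simp [Fin.sum_univ_three, frameMap_apply]; ring

lemma volume_interior_triangle (a b c : ℂ) :
    volume (interior (triangle a b c)) = ENNReal.ofReal (|ori a b c| / 2) := by
  rw [measure_interior_of_null_frontier ((convex_triangle a b c).addHaar_frontier volume),
    volume_triangle]

lemma volume_segment (a b : ℂ) : volume (segment ℝ a b) = 0 := by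
  refine measure_mono_null ((convex_triangle a b b).segment_subset (left_mem_triangle _ _ _)
    (mid_mem_triangle _ _ _)) ?_
  rw [volume_triangle, ori_self_right]; simp

/-- Segments whose ends strictly separate each other intersect. -/
lemma segment_inter_nonempty {p q r s : ℂ} (h1 : ori p q r * ori p q s < 0)
    (h2 : ori r s p * ori r s q < 0) : (segment ℝ p q ∩ segment ℝ r s).Nonempty := by
  have key : ∀ u v : ℝ, u * v < 0 → 0 ≤ u / (u - v) ∧ 0 ≤ -v / (u - v) ∧ u - v ≠ 0 ∧
      -v / (u - v) + u / (u - v) = 1 := by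
    intro u v h
    have hne : u - v ≠ 0 := fun h0 => by
      have : u = v := by linarith
      subst this; nlinarith [mul_self_nonneg u]
    have hpos : 0 < (u - v) ^ 2 := by positivity
    refine ⟨?_, ?_, hne, by field_simp; ring⟩
    · rw [show u / (u - v) = (u * (u - v)) / (u - v) ^ 2 by field_simp]
      exact div_nonneg (by nlinarith [mul_self_nonneg u]) hpos.le
    · rw [show -v / (u - v) = (-v * (u - v)) / (u - v) ^ 2 by field_simp]
      exact div_nonneg (by nlinarith [mul_self_nonneg v]) hpos.le
  obtain ⟨a1, a2, a3, a4⟩ := key _ _ h1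
  obtain ⟨b1, b2, b3, b4⟩ := key _ _ h2
  refine ⟨_, ⟨_, _, b2, b1, b4, rfl⟩, _, _, a2, a1, a4, ?_⟩
  have e : ori r s p - ori r s q = -(ori p q r - ori p q s) := by simp [ori, cross]; ring
  rw [e]
  apply Complex.ext <;> simp only [Complex.add_re, Complex.smul_re, Complex.add_im,
    Complex.smul_im, smul_eq_mul] <;> field_simp <;> simp [ori, cross] <;> ring

/-! ### Regions bounded by a simple quadrilateral. -/

/-- Opposite sides of the quadrilateral `abcd` are disjoint. -/
structure IsSimpleQuad (a b c d : ℂ) : Prop where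
  opp₁ : Disjoint (segment ℝ a b) (segment ℝ c d)
  opp₂ : Disjoint (segment ℝ b c) (segment ℝ d a)

/-- The closed broken line `abcda`. -/
def polygon (a b c d : ℂ) : Set ℂ :=
  segment ℝ a b ∪ segment ℝ b c ∪ segment ℝ c d ∪ segment ℝ d a

lemma polygon_rotate (a b c d : ℂ) : polygon b c d a = polygon a b c d := by
  ext; simp [polygon]; tauto

lemma polygon_reverse (a b c d : ℂ) : polygon a d c b = polygon a b c d := by
  unfold polygon
  rw [segment_symm ℝ a d, segment_symm ℝ d c, segment_symm ℝ c b, segment_symm ℝ b a]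
  ext; simp; tauto

namespace IsSimpleQuad

variable {a b c d : ℂ}

lemma rotate (h : IsSimpleQuad a b c d) : IsSimpleQuad b c d a :=
  ⟨h.opp₂, h.opp₁.symm⟩

lemma reverse (h : IsSimpleQuad a b c d) : IsSimpleQuad a d c b :=
  ⟨by rw [segment_symm ℝ a d, segment_symm ℝ c b]; exact h.opp₂.symm,
   by rw [segment_symm ℝ d c, segment_symm ℝ b a]; exact h.opp₁.symm⟩

lemma ne₁₂ (h : IsSimpleQuad a b c d) : a ≠ b := by
  rintro rfl
  exact h.opp₂.le_bot ⟨left_mem_segment ℝ _ _, right_mem_segment ℝ _ _⟩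

lemma ne₁₃ (h : IsSimpleQuad a b c d) : a ≠ c := by
  rintro rfl
  exact h.opp₁.le_bot ⟨left_mem_segment ℝ _ _, left_mem_segment ℝ _ _⟩

/-- The two other vertices are weakly separated by one of the diagonals. -/
lemma separated (h : IsSimpleQuad a b c d) :
    0 ≤ ori a b c * ori a c d ∨ 0 ≤ ori b c d * ori b d a := by
  by_contra! hn
  obtain ⟨h1, h2⟩ := hn
  have e : ori b c d + ori b d a = ori a b c + ori a c d := by simp [ori, cross]; ring
  have s1 : ori c d a = ori a c d := by rw [← ori_rotate a c d]
  have s2 : ori c d b = ori b c d := by rw [← ori_rotate b c d]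
  have s3 : ori b c a = ori a b c := ori_rotate a b c
  have s4 : ori a b d = ori b d a := by rw [ori_rotate a b d]
  have s5 : ori d a b = ori b d a := by rw [← ori_rotate b d a]
  have s6 : ori d a c = ori a c d := by rw [ori_rotate c d a, s1]
  -- Each diagonal now has its two triangles of strictly opposite orientation. If `abc` and `bda`
  -- have opposite signs, then `ab` crosses `cd`; if equal signs, then `bc` crosses `da`.
  rcases lt_or_ge (ori a b c * ori b d a) 0 with h3 | h3
  · refine not_disjoint_iff_nonempty_inter.2 (segment_inter_nonempty ?_ ?_) h.opp₁
    · rwa [s4]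
    · rw [s1, s2]
      rw [mul_neg_iff] at *
      grind
  · refine not_disjoint_iff_nonempty_inter.2 (segment_inter_nonempty ?_ ?_) h.opp₂
    · rw [s3]
      rw [mul_neg_iff] at *
      rw [mul_nonneg_iff] at h3
      grind
    · rw [s5, s6]
      rw [mul_neg_iff] at *
      rw [mul_nonneg_iff] at h3
      grind

lemma polygon_subset (a b c d : ℂ) : polygon a b c d ⊆ triangle a b c ∪ triangle a c d := by
  have c1 := convex_triangle a b c
  have c2 := convex_triangle a c d
  refine union_subset (union_subset (union_subset ?_ ?_) ?_) ?_
  · exact (c1.segment_subset (left_mem_triangle _ _ _) (mid_mem_triangle _ _ _)).trans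
      subset_union_left
  · exact (c1.segment_subset (mid_mem_triangle _ _ _) (right_mem_triangle _ _ _)).trans
      subset_union_left
  · exact (c2.segment_subset (mid_mem_triangle _ _ _) (right_mem_triangle _ _ _)).trans
      subset_union_right
  · exact (c2.segment_subset (right_mem_triangle _ _ _) (left_mem_triangle _ _ _)).trans
      subset_union_right

/-- A preconnected set off the frontier which meets an open set lies in it. -/
lemma _root_.IsPreconnected.subset_of_disjoint_frontier {X : Type*} [TopologicalSpace X]
    {S F : Set X} (hS : IsPreconnected S)
    (hFo : IsOpen F) (hd : Disjoint S (frontier F)) (hne : (S ∩ F).Nonempty) : S ⊆ F := by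
  refine hS.subset_of_closure_inter_subset hFo hne ?_
  rintro x ⟨hx, hxS⟩
  by_contra hxF
  exact hd.le_bot ⟨hxS, by rw [hFo.frontier_eq]; exact ⟨hx, hxF⟩⟩

/-- Both triangles are star-shaped about `a`. From a point of `F` outside them, the ray pointing
away from `a` never meets them, hence avoids the frontier and stays in `F`, which contradicts
boundedness. -/
lemma subset_triangles {F : Set ℂ} (hFo : IsOpen F) (hFb : Bornology.IsBounded F)
    (hF : frontier F = polygon a b c d) : F ⊆ triangle a b c ∪ triangle a c d := by
  intro p hp
  by_contra hpT
  set T := triangle a b c ∪ triangle a c d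
  have hpa : p ≠ a := fun e => hpT (e ▸ Or.inl (left_mem_triangle _ _ _))
  have hstar : ∀ t : ℝ, 1 ≤ t → a + t • (p - a) ∉ T := by
    intro t ht hmem
    have hin : ∀ S : Set ℂ, Convex ℝ S → a ∈ S → a + t • (p - a) ∈ S → p ∈ S := by
      intro S hS haS hm
      have := hS.add_smul_sub_mem haS hm (t := t⁻¹) ⟨by positivity, inv_le_one_of_one_le₀ ht⟩
      convert this using 1
      rw [add_sub_cancel_left, smul_smul, inv_mul_cancel₀ (by positivity), one_smul]; ring
    rcases hmem with hm | hm
    · exact hpT (Or.inl (hin _ (convex_triangle _ _ _) (left_mem_triangle _ _ _) hm))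
    · exact hpT (Or.inr (hin _ (convex_triangle _ _ _) (left_mem_triangle _ _ _) hm))
  have hpre : IsPreconnected ((fun t : ℝ => a + t • (p - a)) '' Ici 1) :=
    isPreconnected_Ici.image _ (by fun_prop)
  have hsub := hpre.subset_of_disjoint_frontier hFo
    (by
      rw [hF, Set.disjoint_left]
      rintro _ ⟨t, ht, rfl⟩ hm
      exact hstar t ht (polygon_subset _ _ _ _ hm))
    ⟨p, ⟨1, by simp, by simp⟩, hp⟩
  obtain ⟨r, hr⟩ := hFb.subset_closedBall a
  have hn : 0 < ‖p - a‖ := norm_pos_iff.2 (sub_ne_zero.2 hpa)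
  have := hr (hsub ⟨max 1 ((|r| + 1) / ‖p - a‖), by simp, rfl⟩)
  rw [Metric.mem_closedBall, dist_eq_norm, add_sub_cancel_left, norm_smul, Real.norm_eq_abs,
    abs_of_pos (by positivity)] at this
  have h3 : (|r| + 1) / ‖p - a‖ * ‖p - a‖ ≤ max 1 ((|r| + 1) / ‖p - a‖) * ‖p - a‖ := by
    gcongr; exact le_max_right _ _
  rw [div_mul_cancel₀ _ hn.ne'] at h3
  have := le_abs_self r
  linarith

lemma triangle_ori (h₁ : 0 ≤ ori a b c) {p : ℂ} (hp : p ∈ triangle a b c) :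
    0 ≤ ori a b p ∧ 0 ≤ ori b c p ∧ 0 ≤ ori c a p := by
  refine ⟨?_, ?_, ?_⟩
  · exact triangle_subset (convex_ori_nonneg a b) (by simp [ori_self_left])
      (by simp [ori_self_right]) h₁ hp
  · exact triangle_subset (convex_ori_nonneg b c) (by simpa [ori_rotate] using h₁)
      (by simp [ori_self_left]) (by simp [ori_self_right]) hp
  · exact triangle_subset (convex_ori_nonneg c a) (by simp [ori_self_right])
      (by simpa [ori_rotate] using h₁) (by simp [ori_self_left]) hp


lemma interior_triangle_ori (h₁ : 0 ≤ ori a b c) {p : ℂ} (hp : p ∈ interior (triangle a b c))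
    (hab : a ≠ b) (hbc : b ≠ c) (hca : c ≠ a) : 0 < ori a b p ∧ 0 < ori b c p ∧ 0 < ori c a p :=
  ⟨interior_subset_ori_pos hab (fun _ hq => (triangle_ori h₁ hq).1) hp,
    interior_subset_ori_pos hbc (fun _ hq => (triangle_ori h₁ hq).2.1) hp,
    interior_subset_ori_pos hca (fun _ hq => (triangle_ori h₁ hq).2.2) hp⟩

lemma ori_sum (a b c p : ℂ) : ori a b p + ori b c p + ori c a p = ori a b c := by
  simp [ori, cross]; ring

/-- Interior points are strictly to the left of `ab`, `bc` and `ca`, while `cd` and `da` lie weakly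
on the other side of `ca`. -/
lemma disjoint_interior_polygon (h : IsSimpleQuad a b c d) (h₁ : 0 ≤ ori a b c)
    (h₂ : 0 ≤ ori a c d) : Disjoint (interior (triangle a b c)) (polygon a b c d) := by
  rw [Set.disjoint_left]
  intro p hp hm
  obtain ⟨i1, i2, i3⟩ := interior_triangle_ori h₁ hp h.ne₁₂ h.rotate.ne₁₂ h.ne₁₃.symm
  have h4 : ∀ q ∈ triangle a c d, ori c a q ≤ 0 := fun q hq => by
    have := (triangle_ori h₂ hq).1
    rw [ori_swap]; linarith
  rcases hm with ((hm | hm) | hm) | hm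
  · exact i1.ne' (ori_eq_zero_of_mem_segment hm)
  · exact i2.ne' (ori_eq_zero_of_mem_segment hm)
  · have := h4 _ ((convex_triangle a c d).segment_subset (mid_mem_triangle _ _ _)
      (right_mem_triangle _ _ _) hm)
    linarith
  · have := h4 _ ((convex_triangle a c d).segment_subset (right_mem_triangle _ _ _)
      (left_mem_triangle _ _ _) hm)
    linarith

lemma triangle_rotate (a b c : ℂ) : triangle b c a = triangle a b c := by
  apply subset_antisymm <;> refine triangle_subset (convex_triangle _ _ _) ?_ ?_ ?_ <;>
  first
  | exact left_mem_triangle _ _ _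
  | exact mid_mem_triangle _ _ _
  | exact right_mem_triangle _ _ _

lemma disjoint_interior_polygon' (h : IsSimpleQuad a b c d) (h₁ : 0 ≤ ori a b c)
    (h₂ : 0 ≤ ori a c d) : Disjoint (interior (triangle a c d)) (polygon a b c d) := by
  have := disjoint_interior_polygon h.rotate.rotate
    (by rwa [← ori_rotate] at h₂) (by rwa [← ori_rotate])
  rwa [polygon_rotate, polygon_rotate, triangle_rotate] at this

/-- The region bounded by a simple quadrilateral contains both triangles of a triangulation. -/
lemma interior_subset (h : IsSimpleQuad a b c d) (h₁ : 0 ≤ ori a b c) (h₂ : 0 ≤ ori a c d)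
    {F : Set ℂ} (hFo : IsOpen F) (hFb : Bornology.IsBounded F) (hFn : F.Nonempty)
    (hF : frontier F = polygon a b c d) :
    interior (triangle a b c) ⊆ F ∧ interior (triangle a c d) ⊆ F := by
  have d1 := disjoint_interior_polygon h h₁ h₂
  have d2 := disjoint_interior_polygon' h h₁ h₂
  rw [← hF] at d1 d2
  have p1 : IsPreconnected (interior (triangle a b c)) :=
    (convex_triangle a b c).interior.isPreconnected
  have p2 : IsPreconnected (interior (triangle a c d)) :=
    (convex_triangle a c d).interior.isPreconnected
  -- Otherwise the open set `F` would lie in the frontiers of two convex sets, which are null.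
  have hmeet : (interior (triangle a b c) ∩ F).Nonempty ∨
      (interior (triangle a c d) ∩ F).Nonempty := by
    by_contra! hn
    have hsub : F ⊆ frontier (triangle a b c) ∪ frontier (triangle a c d) := by
      intro p hp
      rcases subset_triangles hFo hFb hF hp with hm | hm
      · refine Or.inl ⟨subset_closure hm, fun hi => ?_⟩
        exact (hn.1.le ⟨hi, hp⟩).elim
      · refine Or.inr ⟨subset_closure hm, fun hi => ?_⟩
        exact (hn.2.le ⟨hi, hp⟩).elim
    have h0 := measure_mono_null hsub (measure_union_null
      ((convex_triangle a b c).addHaar_frontier volume)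
      ((convex_triangle a c d).addHaar_frontier volume))
    exact (hFo.measure_pos volume hFn).ne' h0
  by_cases e1 : (interior (triangle a b c)).Nonempty
  · by_cases e2 : (interior (triangle a c d)).Nonempty
    -- With both triangles nondegenerate, the midpoint of the diagonal is off the polygon and in the
    -- closure of both interiors, so it joins them into one connected set.
    · set m : ℂ := midpoint ℝ a c with hm
      have pos1 : 0 < ori a b c := by
        obtain ⟨p, hp⟩ := e1
        obtain ⟨i1, i2, i3⟩ := interior_triangle_ori h₁ hp h.ne₁₂ h.rotate.ne₁₂ h.ne₁₃.symm
        rw [← ori_sum a b c p]; positivity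
      have pos2 : 0 < ori a c d := by
        obtain ⟨p, hp⟩ := e2
        obtain ⟨i1, i2, i3⟩ := interior_triangle_ori h₂ hp h.ne₁₃
          h.rotate.rotate.ne₁₂ h.rotate.rotate.rotate.ne₁₂
        rw [← ori_sum a c d p]; positivity
      have mT : ∀ S : Set ℂ, Convex ℝ S → a ∈ S → c ∈ S → m ∈ S := fun S hS ha hc =>
        hS.segment_subset ha hc (midpoint_mem_segment a c)
      have mo : ∀ p q : ℂ, ori p q m = (ori p q a + ori p q c) / 2 := by
        intro p q
        rw [hm, midpoint_eq_smul_add, smul_add, ori_combo _ _ _ _ _ _ (by norm_num)]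
        norm_num; ring
      have mP : m ∉ frontier F := by
        rw [hF]
        rintro (((hm | hm) | hm) | hm) <;> have := ori_eq_zero_of_mem_segment hm <;>
          rw [mo] at this
        · rw [ori_self_left] at this; linarith
        · rw [ori_self_right, ori_rotate] at this; linarith
        · rw [ori_self_left, ori_rotate] at this; linarith
        · rw [ori_self_right, ← ori_rotate] at this; linarith
      have q1 : IsPreconnected (insert m (interior (triangle a b c))) := by
        refine p1.subset_closure (subset_insert _ _) (insert_subset ?_ subset_closure)
        rw [(convex_triangle a b c).closure_interior_eq_closure_of_nonempty_interior e1]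
        exact subset_closure (mT _ (convex_triangle _ _ _) (left_mem_triangle _ _ _)
          (right_mem_triangle _ _ _))
      have q2 : IsPreconnected (insert m (interior (triangle a c d))) := by
        refine p2.subset_closure (subset_insert _ _) (insert_subset ?_ subset_closure)
        rw [(convex_triangle a c d).closure_interior_eq_closure_of_nonempty_interior e2]
        exact subset_closure (mT _ (convex_triangle _ _ _) (left_mem_triangle _ _ _)
          (mid_mem_triangle _ _ _))
      have q := q1.union m (mem_insert _ _) (mem_insert _ _) q2
      have hs := q.subset_of_disjoint_frontier hFo
        (by
          rw [Set.disjoint_left]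
          rintro x ((rfl | hx) | (rfl | hx))
          · exact mP
          · exact d1.notMem_of_mem_left hx
          · exact mP
          · exact d2.notMem_of_mem_left hx)
        (by
          rcases hmeet with ⟨x, hx⟩ | ⟨x, hx⟩
          · exact ⟨x, Or.inl (Or.inr hx.1), hx.2⟩
          · exact ⟨x, Or.inr (Or.inr hx.1), hx.2⟩)
      exact ⟨((subset_insert _ _).trans subset_union_left).trans hs,
        ((subset_insert _ _).trans subset_union_right).trans hs⟩
    · rw [not_nonempty_iff_eq_empty] at e2
      rw [e2] at hmeet ⊢
      refine ⟨p1.subset_of_disjoint_frontier hFo d1 ?_, empty_subset _⟩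
      simpa using hmeet
  · rw [not_nonempty_iff_eq_empty] at e1
    rw [e1] at hmeet ⊢
    refine ⟨empty_subset _, p2.subset_of_disjoint_frontier hFo d2 ?_⟩
    simpa using hmeet

/-- `F` lies between the union of the open triangles, which are disjoint because `ac` separates
them, and the union of the closed ones; both unions have the same measure. -/
lemma volume_eq (h : IsSimpleQuad a b c d) (h₁ : 0 ≤ ori a b c) (h₂ : 0 ≤ ori a c d)
    {F : Set ℂ} (hFo : IsOpen F) (hFb : Bornology.IsBounded F) (hFn : F.Nonempty)
    (hF : frontier F = polygon a b c d) :
    volume F = ENNReal.ofReal (cross (c - a) (d - b) / 2) := by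
  have e : cross (c - a) (d - b) / 2 = |ori a b c| / 2 + |ori a c d| / 2 := by
    rw [abs_of_nonneg h₁, abs_of_nonneg h₂]; simp [ori, cross]; ring
  rw [e, ENNReal.ofReal_add (by positivity) (by positivity)]
  obtain ⟨s1, s2⟩ := interior_subset h h₁ h₂ hFo hFb hFn hF
  apply le_antisymm
  · refine (measure_mono (subset_triangles hFo hFb hF)).trans ((measure_union_le _ _).trans ?_)
    rw [volume_triangle, volume_triangle]
  · rw [← volume_interior_triangle, ← volume_interior_triangle, ← measure_union _
      isOpen_interior.measurableSet]
    · exact measure_mono (union_subset s1 s2)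
    · rw [Set.disjoint_left]
      intro p hp hq
      have := (interior_triangle_ori h₁ hp h.ne₁₂ h.rotate.ne₁₂ h.ne₁₃.symm).2.2
      have := (interior_triangle_ori h₂ hq h.ne₁₃
          h.rotate.rotate.ne₁₂ h.rotate.rotate.rotate.ne₁₂).1
      rw [ori_swap] at this
      linarith

/-- If `b` were on the line `ac` but beyond `a`, then `a` would lie on `bc`; if beyond `c`, then `c`
would lie on `ab`. Either way two opposite sides would meet. -/
lemma exists_combo_of_ori_eq_zero (h : IsSimpleQuad a b c d) (h₀ : ori a b c = 0) :
    ∃ s t : ℝ, 0 ≤ s ∧ 0 ≤ t ∧ s + t = 1 ∧ b = s • a + t • c := by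
  have hca : c - a ≠ 0 := sub_ne_zero.2 h.ne₁₃.symm
  obtain ⟨t, ht⟩ : ∃ t : ℝ, b - a = t * (c - a) := by
    refine ⟨((b - a) / (c - a)).re, ?_⟩
    have him : ((b - a) / (c - a)).im = 0 := by
      have : (b - a).im * (c - a).re = (b - a).re * (c - a).im := by
        simp only [ori, cross] at h₀; linarith
      rw [Complex.div_im, this]; ring
    have : ((((b - a) / (c - a)).re : ℝ) : ℂ) = (b - a) / (c - a) :=
      Complex.ext (by simp) (by simp [him])
    rw [this, div_mul_cancel₀ _ hca]
  have hb : b = (1 - t) • a + t • c := by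
    simp only [Complex.real_smul]; push_cast; linear_combination ht
  have t0 : 0 ≤ t := by
    by_contra! hneg
    refine h.opp₂.le_bot ⟨?_, right_mem_segment ℝ d a⟩
    have hp : 0 < 1 - t := by linarith
    refine ⟨1 / (1 - t), -t / (1 - t), by positivity, div_nonneg (by linarith) (by linarith),
      by field_simp; ring, ?_⟩
    rw [hb]
    have : (1 : ℂ) - t ≠ 0 := by
      have : (1 : ℝ) - t ≠ 0 := by linarith
      exact_mod_cast this
    simp only [Complex.real_smul]; push_cast; field_simp; ring
  have t1 : t ≤ 1 := by
    by_contra! hneg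
    refine h.opp₁.le_bot ⟨?_, left_mem_segment ℝ c d⟩
    have ht0 : (t : ℂ) ≠ 0 := by exact_mod_cast (by linarith : t ≠ 0)
    refine ⟨(t - 1) / t, 1 / t, div_nonneg (by linarith) (by linarith), by positivity,
      by field_simp; ring, ?_⟩
    rw [hb]
    simp only [Complex.real_smul]; push_cast; field_simp; ring
  exact ⟨1 - t, t, by linarith, t0, by ring, hb⟩

/-- Near an inner point of one of the sides `ab`, `bc`, the region lies on one side of it. -/
lemma eventually_ori_aux (h : IsSimpleQuad a b c d) (h₁ : 0 ≤ ori a b c) (h₂ : 0 ≤ ori a c d)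
    {F : Set ℂ} (hFo : IsOpen F) (hFb : Bornology.IsBounded F)
    (hF : frontier F = polygon a b c d) {m : ℂ}
    (hm : m ∈ openSegment ℝ a b ∨ m ∈ openSegment ℝ b c) :
    ∀ᶠ p in 𝓝 m, p ∈ F → 0 ≤ ori a b p ∧ 0 ≤ ori b c p := by
  by_cases hm2 : m ∈ triangle a c d
  swap
  · filter_upwards [(isClosed_triangle a c d).isOpen_compl.mem_nhds hm2] with p hp hpF
    rcases subset_triangles hFo hFb hF hpF with hT | hT
    · exact ⟨(triangle_ori h₁ hT).1, (triangle_ori h₁ hT).2.1⟩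
    · exact (hp hT).elim
  -- A side of `abc` touches the other triangle at an inner point only if `abc` is flat. Then `b` is
  -- on the segment `ac`, and being left of `ac` gives being weakly left of `ab` and of `bc`.
  · have g1 := (triangle_ori h₂ hm2).1
    have hz : ori a b c = 0 := by
      have e : ori a c b = -ori a b c := by simp [ori, cross]; ring
      rcases hm with ⟨s, t, hs, ht, hst, rfl⟩ | ⟨s, t, hs, ht, hst, rfl⟩
      · rw [ori_combo _ _ _ _ _ _ hst, ori_self_left, e] at g1
        nlinarith
      · rw [ori_combo _ _ _ _ _ _ hst, ori_self_right, e] at g1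
        nlinarith
    obtain ⟨s, t, hs, ht, hst, hb⟩ := h.exists_combo_of_ori_eq_zero hz
    refine Eventually.of_forall fun p hp => ?_
    rcases subset_triangles hFo hFb hF hp with hT | hT
    · exact ⟨(triangle_ori h₁ hT).1, (triangle_ori h₁ hT).2.1⟩
    · have g2 := (triangle_ori h₂ hT).1
      obtain rfl : s = 1 - t := by linarith
      have e1 : ori a b p = t * ori a c p := by rw [hb]; simp [ori, cross]; ring
      have e2 : ori b c p = (1 - t) * ori a c p := by rw [hb]; simp [ori, cross]; ring
      rw [e1, e2]
      exact ⟨by positivity, by positivity⟩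

/-- A region `F` is positively (`ε = 1`) or negatively (`ε = -1`) oriented with respect to the
listing `a, b, c, d` of the vertices of its boundary. -/
structure _root_.IsOriented (F : Set ℂ) (ε : ℝ) (a b c d : ℂ) : Prop where
  sign : ε = 1 ∨ ε = -1
  pos : 0 < ε * cross (c - a) (d - b)
  volume_eq : volume F = ENNReal.ofReal (ε * cross (c - a) (d - b) / 2)
  side₁ : ∀ m ∈ openSegment ℝ a b, ∀ᶠ p in 𝓝 m, p ∈ F → 0 ≤ ε * ori a b p
  side₂ : ∀ m ∈ openSegment ℝ b c, ∀ᶠ p in 𝓝 m, p ∈ F → 0 ≤ ε * ori b c p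
  side₃ : ∀ m ∈ openSegment ℝ c d, ∀ᶠ p in 𝓝 m, p ∈ F → 0 ≤ ε * ori c d p
  side₄ : ∀ m ∈ openSegment ℝ d a, ∀ᶠ p in 𝓝 m, p ∈ F → 0 ≤ ε * ori d a p
  subset : ∀ S : Set ℂ, Convex ℝ S → a ∈ S → b ∈ S → c ∈ S → d ∈ S → F ⊆ S

lemma isOriented_of_nonneg (h : IsSimpleQuad a b c d) (h₁ : 0 ≤ ori a b c) (h₂ : 0 ≤ ori a c d)
    {F : Set ℂ} (hFo : IsOpen F) (hFb : Bornology.IsBounded F) (hFn : F.Nonempty)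
    (hF : frontier F = polygon a b c d) : IsOriented F 1 a b c d := by
  -- Renaming the vertices by a half turn keeps the diagonal `ac` and turns the statements about
  -- `ab`, `bc` into those about `cd`, `da`.
  have hF' : frontier F = polygon c d a b := by rw [hF, polygon_rotate, polygon_rotate]
  have h₁' : 0 ≤ ori c d a := by rwa [← ori_rotate] at h₂
  have h₂' : 0 ≤ ori c a b := by rwa [← ori_rotate]
  have hv := volume_eq h h₁ h₂ hFo hFb hFn hF
  refine ⟨Or.inl rfl, ?_, by simpa using hv, ?_, ?_, ?_, ?_, ?_⟩
  · have := hFo.measure_pos volume hFn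
    rw [hv, ENNReal.ofReal_pos] at this
    linarith
  · intro m hm
    filter_upwards [eventually_ori_aux h h₁ h₂ hFo hFb hF (Or.inl hm)] with p hp hpF
    simpa using (hp hpF).1
  · intro m hm
    filter_upwards [eventually_ori_aux h h₁ h₂ hFo hFb hF (Or.inr hm)] with p hp hpF
    simpa using (hp hpF).2
  · intro m hm
    filter_upwards [eventually_ori_aux h.rotate.rotate h₁' h₂' hFo hFb hF' (Or.inl hm)]
      with p hp hpF
    simpa using (hp hpF).1
  · intro m hm
    filter_upwards [eventually_ori_aux h.rotate.rotate h₁' h₂' hFo hFb hF' (Or.inr hm)]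
      with p hp hpF
    simpa using (hp hpF).2
  · intro S hS ha hb hc hd
    exact (subset_triangles hFo hFb hF).trans
      (union_subset (triangle_subset hS ha hb hc) (triangle_subset hS ha hc hd))

lemma _root_.IsOriented.rotate {F : Set ℂ} {ε : ℝ} (h : IsOriented F ε b c d a) :
    IsOriented F ε a b c d := by
  have e : cross (d - b) (a - c) = cross (c - a) (d - b) := by simp [cross]; ring
  refine ⟨h.sign, e ▸ h.pos, e ▸ h.volume_eq, h.side₄, h.side₁, h.side₂, h.side₃, ?_⟩
  intro S hS ha hb hc hd
  exact h.subset S hS hb hc hd ha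

lemma _root_.IsOriented.reverse {F : Set ℂ} {ε : ℝ} (h : IsOriented F ε a d c b) :
    IsOriented F (-ε) a b c d := by
  have e : ε * cross (c - a) (b - d) = -ε * cross (c - a) (d - b) := by simp [cross]; ring
  have e' : ∀ p q r, -ε * ori p q r = ε * ori q p r := fun p q r => by rw [ori_swap]; ring
  refine ⟨?_, e ▸ h.pos, e ▸ h.volume_eq, ?_, ?_, ?_, ?_, ?_⟩
  · rcases h.sign with h | h <;> simp [h]
  · intro m hm
    simp_rw [e']
    exact h.side₄ m (by rwa [openSegment_symm])
  · intro m hm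
    simp_rw [e']
    exact h.side₃ m (by rwa [openSegment_symm])
  · intro m hm
    simp_rw [e']
    exact h.side₂ m (by rwa [openSegment_symm])
  · intro m hm
    simp_rw [e']
    exact h.side₁ m (by rwa [openSegment_symm])
  · intro S hS ha hb hc hd
    exact h.subset S hS ha hd hc hb

lemma exists_isOriented_aux (h : IsSimpleQuad a b c d) (h₀ : 0 ≤ ori a b c * ori a c d)
    {F : Set ℂ} (hFo : IsOpen F) (hFb : Bornology.IsBounded F) (hFn : F.Nonempty)
    (hF : frontier F = polygon a b c d) : ∃ ε, IsOriented F ε a b c d := by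
  rcases mul_nonneg_iff.1 h₀ with ⟨h1, h2⟩ | ⟨h1, h2⟩
  · exact ⟨1, h.isOriented_of_nonneg h1 h2 hFo hFb hFn hF⟩
  · refine ⟨-1, (h.reverse.isOriented_of_nonneg ?_ ?_ hFo hFb hFn ?_).reverse⟩
    · have : ori a d c = -ori a c d := by simp [ori, cross]; ring
      linarith
    · have : ori a c b = -ori a b c := by simp [ori, cross]; ring
      linarith
    · rw [hF, polygon_reverse]

/-- A bounded region whose frontier is a simple quadrilateral. -/
lemma exists_isOriented (h : IsSimpleQuad a b c d)
    {F : Set ℂ} (hFo : IsOpen F) (hFb : Bornology.IsBounded F) (hFn : F.Nonempty)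
    (hF : frontier F = polygon a b c d) : ∃ ε, IsOriented F ε a b c d := by
  rcases h.separated with h0 | h0
  · exact h.exists_isOriented_aux h0 hFo hFb hFn hF
  · obtain ⟨ε, hε⟩ := h.rotate.exists_isOriented_aux h0 hFo hFb hFn
      (by rw [hF, polygon_rotate a b c d])
    exact ⟨ε, hε.rotate⟩

end IsSimpleQuad

/-! ### Faces of a plane graph and the local picture at an edge. -/

namespace PlaneGraph

variable (Q : PlaneGraph)

lemma finite_adj : {p : ℂ × ℂ | Q.graph.Adj p.1 p.2}.Finite :=
  ((Q.verts ×ˢ Q.verts).finite_toSet).subset fun p hp => by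
    simpa using ⟨Q.mem_verts _ _ hp, Q.mem_verts _ _ hp.symm⟩

lemma support_eq : Q.support =
    (Q.verts : Set ℂ) ∪ ⋃ p ∈ {p : ℂ × ℂ | Q.graph.Adj p.1 p.2}, segment ℝ p.1 p.2 := by
  ext z; simp [support]

lemma isClosed_segment (a b : ℂ) : IsClosed (segment ℝ a b) := by
  rw [segment_eq_image]
  exact (isCompact_Icc.image (by fun_prop)).isClosed

lemma isClosed_support : IsClosed Q.support := by
  rw [support_eq]
  exact Q.verts.finite_toSet.isClosed.union
    (Q.finite_adj.isClosed_biUnion fun p _ => isClosed_segment _ _)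

lemma volume_support : volume Q.support = 0 := by
  rw [support_eq]
  refine measure_union_null (Q.verts.finite_toSet.measure_zero _)
    ((measure_biUnion_null_iff Q.finite_adj.countable).2 fun p _ => volume_segment _ _)

lemma dist_le_maxEdge {a b : ℂ} (h : Q.graph.Adj a b) : dist a b ≤ Q.maxEdge := by
  refine le_csSup ?_ ⟨a, b, h, rfl⟩
  refine ((Q.finite_adj.image fun p => dist p.1 p.2).subset ?_).bddAbove
  rintro _ ⟨a, b, h, rfl⟩
  exact ⟨(a, b), h, rfl⟩

lemma maxEdge_nonneg : 0 ≤ Q.maxEdge :=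
  Real.sSup_nonneg (by rintro _ ⟨a, b, _, rfl⟩; positivity)

lemma maxEdge_pos {a b : ℂ} (h : Q.graph.Adj a b) : 0 < Q.maxEdge :=
  (dist_pos.2 h.ne).trans_le (Q.dist_le_maxEdge h)

lemma isOpen_inside : IsOpen Q.inside := by
  rw [inside, boundary, ← closure_eq_self_union_frontier]
  exact isClosed_closure.isOpen_compl

variable {Q}

section Faces

variable {F G : Set ℂ}

lemma isOpen_face (hF : F ∈ Q.faces) : IsOpen F := by
  obtain ⟨_, z, _, rfl⟩ := hF
  exact Q.isClosed_support.isOpen_compl.connectedComponentIn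

lemma face_nonempty (hF : F ∈ Q.faces) : F.Nonempty := by
  obtain ⟨_, z, hz, rfl⟩ := hF
  exact ⟨z, mem_connectedComponentIn hz⟩

lemma face_subset (hF : F ∈ Q.faces) : F ⊆ Q.supportᶜ := by
  obtain ⟨_, z, hz, rfl⟩ := hF
  exact connectedComponentIn_subset _ _

lemma subset_face {S : Set ℂ} (hF : F ∈ Q.faces) (hS : IsPreconnected S)
    (hSQ : Disjoint S Q.support) (hne : (S ∩ F).Nonempty) : S ⊆ F := by
  obtain ⟨_, z, hz, rfl⟩ := hF
  obtain ⟨x, hxS, hx⟩ := hne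
  rw [connectedComponentIn_eq hx]
  exact hS.subset_connectedComponentIn hxS hSQ.subset_compl_right

lemma face_eq (hF : F ∈ Q.faces) (hG : G ∈ Q.faces) (hne : (F ∩ G).Nonempty) : F = G := by
  obtain ⟨_, z, hz, rfl⟩ := hF
  obtain ⟨_, w, hw, rfl⟩ := hG
  obtain ⟨x, hx, hx'⟩ := hne
  rw [connectedComponentIn_eq hx, connectedComponentIn_eq hx']

/-- If the component containing `S` were unbounded, `closure S` would lie in the closure of the
outer face, whose complement is `Q.inside`. -/
lemma exists_face {S : Set ℂ} (hS : IsPreconnected S) (hSQ : Disjoint S Q.support)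
    {x : ℂ} (hx : x ∈ S) (hin : ∃ m ∈ Q.inside, m ∈ closure S) : ∃ F ∈ Q.faces, S ⊆ F := by
  have hxQ : x ∈ Q.supportᶜ := hSQ.subset_compl_right hx
  refine ⟨connectedComponentIn Q.supportᶜ x, ⟨?_, x, hxQ, rfl⟩,
    hS.subset_connectedComponentIn hx hSQ.subset_compl_right⟩
  by_contra hb
  obtain ⟨m, hm, hmS⟩ := hin
  rw [inside, boundary, ← closure_eq_self_union_frontier] at hm
  refine hm (closure_mono ?_ hmS)
  intro y hy
  have hy' := hS.subset_connectedComponentIn hx hSQ.subset_compl_right hy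
  refine ⟨hSQ.subset_compl_right hy, ?_⟩
  rwa [← connectedComponentIn_eq hy']

end Faces

namespace IsQuadrilateral

variable {F : Set ℂ} {z : Fin 4 → ℂ}

lemma vert_mem (h : Q.IsQuadrilateral F z) (i : Fin 4) : z i ∈ Q.verts := Q.mem_verts _ _ (h.adj i)

lemma isSimpleQuad (h : Q.IsQuadrilateral F z) : IsSimpleQuad (z 0) (z 1) (z 2) (z 3) := by
  have hne : ∀ i j : Fin 4, i ≠ j → z i ≠ z j := fun i j => h.injective.ne
  have key : ∀ i : Fin 4, Disjoint (segment ℝ (z i) (z (i + 1)))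
      (segment ℝ (z (i + 2)) (z (i + 3))) := by
    intro i
    rw [Set.disjoint_iff]
    have hadj : Q.graph.Adj (z (i + 2)) (z (i + 3)) := by
      have := h.adj (i + 2)
      rwa [add_assoc] at this
    have h1 := hne i (i + 2) (by clear * -; revert i; decide)
    have h2 := hne i (i + 3) (by clear * -; revert i; decide)
    have h3 := hne (i + 1) (i + 2) (by clear * -; revert i; decide)
    have h4 := hne (i + 1) (i + 3) (by clear * -; revert i; decide)
    refine (Q.edge_edge _ _ _ _ (h.adj i) hadj ?_).trans ?_
    · intro e
      rw [Sym2.eq_iff] at e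
      tauto
    · rintro x ⟨rfl | rfl, hx | hx⟩
      · exact h1 hx
      · exact h2 hx
      · exact h3 hx
      · exact h4 hx
  exact ⟨key 0, key 1⟩

lemma frontier_eq_polygon (h : Q.IsQuadrilateral F z) :
    frontier F = polygon (z 0) (z 1) (z 2) (z 3) := by
  rw [h.frontier_eq]
  ext x
  simp [polygon, Fin.exists_fin_succ, or_assoc]

lemma vert_mem_closure (h : Q.IsQuadrilateral F z) (i : Fin 4) : z i ∈ closure F := by
  refine frontier_subset_closure ?_
  rw [h.frontier_eq]
  exact mem_iUnion.2 ⟨i, left_mem_segment ℝ _ _⟩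

/-- Two corners are at most two sides apart; this is why `h` is twice the maximal edge length. -/
lemma dist_le (h : Q.IsQuadrilateral F z) (i j : Fin 4) : dist (z i) (z j) ≤ Q.h := by
  have h0 := Q.maxEdge_nonneg
  have h1 : ∀ i, dist (z i) (z (i + 1)) ≤ Q.maxEdge := fun i => Q.dist_le_maxEdge (h.adj i)
  have h2 : ∀ i, dist (z i) (z (i + 2)) ≤ Q.h := by
    intro i
    have h2 : dist (z (i + 1)) (z (i + 2)) ≤ Q.maxEdge := by
      have := h1 (i + 1)
      rwa [add_assoc] at this
    calc _ ≤ dist (z i) (z (i + 1)) + dist (z (i + 1)) (z (i + 2)) := dist_triangle _ _ _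
      _ ≤ _ := by rw [PlaneGraph.h]; linarith [h1 i]
  have h3 : Q.maxEdge ≤ Q.h := by rw [PlaneGraph.h]; linarith
  have : j = i ∨ j = i + 1 ∨ j = i + 2 ∨ i = j + 1 := by revert i j; decide
  rcases this with rfl | rfl | rfl | rfl
  · simpa using h0.trans h3
  · exact (h1 _).trans h3
  · exact h2 _
  · rw [dist_comm]; exact (h1 _).trans h3

end IsQuadrilateral

/-- Near an inner point of an edge, the graph consists of the edge only, which is straight. -/
lemma eventually_mem_edge {a b m : ℂ} (hab : Q.graph.Adj a b) (hm : m ∈ openSegment ℝ a b) :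
    ∀ᶠ p in 𝓝 m, (p ∈ Q.support → ori a b p = 0) ∧ (ori a b p = 0 → p ∈ Q.support) := by
  have hms : m ∈ segment ℝ a b := openSegment_subset_segment _ _ _ hm
  have hma : m ≠ a := by
    rintro rfl
    exact hab.ne (left_mem_openSegment_iff.1 hm)
  have hmb : m ≠ b := by
    rintro rfl
    exact hab.ne (right_mem_openSegment_iff.1 hm)
  have hba : b - a ≠ 0 := sub_ne_zero.2 hab.ne.symm
  -- All vertices and all other edges: a closed set missing `m`. Staying off it, with the parameter
  -- along `ab` kept in `(0, 1)`, identifies the graph near `m` with the line `ab`.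
  set K : Set ℂ := (Q.verts : Set ℂ) ∪
    ⋃ p ∈ {p : ℂ × ℂ | Q.graph.Adj p.1 p.2 ∧ s(a, b) ≠ s(p.1, p.2)}, segment ℝ p.1 p.2 with hK
  have hKc : IsClosed K := Q.verts.finite_toSet.isClosed.union
    ((Q.finite_adj.subset fun p hp => hp.1).isClosed_biUnion fun p _ => isClosed_segment _ _)
  have hmK : m ∉ K := by
    rintro (hv | he)
    · rcases Q.vert_edge a b m hab hv hms with e | e <;> contradiction
    · simp only [mem_ofPred_eq, mem_iUnion] at he
      obtain ⟨p, ⟨hp, hne⟩, hmp⟩ := he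
      rcases (Q.edge_edge _ _ _ _ hab hp hne ⟨hms, hmp⟩).1 with e | e <;> contradiction
  have hcont : Continuous fun p : ℂ => ((p - a) / (b - a)).re :=
    Complex.continuous_re.comp (by fun_prop)
  have hpar : ((m - a) / (b - a)).re ∈ Ioo (0 : ℝ) 1 := by
    obtain ⟨s, t, hs, ht, hst, rfl⟩ := hm
    obtain rfl : s = 1 - t := by linarith
    have : ((1 - t) • a + t • b - a) / (b - a) = (t : ℂ) := by
      simp only [Complex.real_smul]; push_cast; field_simp; ring
    rw [this]
    simp only [Complex.ofReal_re]
    exact ⟨ht, by linarith⟩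
  filter_upwards [hKc.isOpen_compl.mem_nhds hmK,
    hcont.continuousAt.eventually_mem (isOpen_Ioo.mem_nhds hpar)] with p hpK hpI
  constructor
  · rintro (hv | ⟨c, d, hcd, hp⟩)
    · exact (hpK (Or.inl hv)).elim
    · by_cases hs : s(a, b) = s(c, d)
      · rw [Sym2.eq_iff] at hs
        rcases hs with ⟨rfl, rfl⟩ | ⟨rfl, rfl⟩
        · exact ori_eq_zero_of_mem_segment hp
        · rw [segment_symm] at hp
          exact ori_eq_zero_of_mem_segment hp
      · refine (hpK (Or.inr ?_)).elim
        simp only [mem_ofPred_eq, mem_iUnion]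
        exact ⟨(c, d), ⟨hcd, hs⟩, hp⟩
  · intro h0
    refine Or.inr ⟨a, b, hab, 1 - ((p - a) / (b - a)).re, ((p - a) / (b - a)).re,
      by linarith [hpI.2], hpI.1.le, by ring, ?_⟩
    have him : ((p - a) / (b - a)).im = 0 := by
      have : (p - a).im * (b - a).re = (p - a).re * (b - a).im := by
        simp only [ori, cross] at h0; linarith
      rw [Complex.div_im, this]; ring
    have e : ((((p - a) / (b - a)).re : ℝ) : ℂ) = (p - a) / (b - a) :=
      Complex.ext (by simp) (by simp [him])
    simp only [Complex.real_smul]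
    push_cast
    rw [e]; field_simp; ring

/-- The half of the disk `B(m, δ)` to the left of `ab`. -/
def halfDisk (a b m : ℂ) (δ : ℝ) : Set ℂ := Metric.ball m δ ∩ {p | 0 < ori a b p}

lemma isPreconnected_halfDisk (a b m : ℂ) (δ : ℝ) : IsPreconnected (halfDisk a b m δ) :=
  ((convex_ball m δ).inter (convex_ori_pos a b)).isPreconnected

lemma mem_closure_halfDisk {a b m : ℂ} {δ : ℝ} (hδ : 0 < δ) (hab : a ≠ b) (hm : ori a b m = 0) :
    m ∈ closure (halfDisk a b m δ) := by
  have hc : Continuous fun t : ℝ => m + (t : ℂ) * (Complex.I * (b - a)) := by fun_prop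
  have h1 : Tendsto (fun t : ℝ => m + (t : ℂ) * (Complex.I * (b - a))) (𝓝[>] 0) (𝓝 m) := by
    have := hc.tendsto 0
    simp only [Complex.ofReal_zero, zero_mul, add_zero] at this
    exact this.mono_left nhdsWithin_le_nhds
  refine mem_closure_of_tendsto h1 ?_
  filter_upwards [h1.eventually_mem (Metric.ball_mem_nhds m hδ), self_mem_nhdsWithin] with t ht ht0
  refine ⟨ht, ?_⟩
  have h2 : ori a b (m + (t : ℂ) * (Complex.I * (b - a))) =
      ori a b m + t * Complex.normSq (b - a) := by
    simp [ori, cross, Complex.normSq_apply]; ring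
  have h3 : 0 < Complex.normSq (b - a) := Complex.normSq_pos.2 (sub_ne_zero.2 hab.symm)
  simp only [mem_ofPred_eq]
  rw [h2, hm, zero_add]
  exact mul_pos ht0 h3

end PlaneGraph

/-! ### Directed sides of faces and the cancellation over inner edges. -/

namespace QuadLattice

open PlaneGraph

variable (Q : QuadLattice) {F G : Set ℂ}

lemma corner_spec (hF : F ∈ Q.faces) : Q.IsQuadrilateral F (Q.corner F) :=
  Classical.epsilon_spec (Q.quad F hF)

lemma exists_sgn (hF : F ∈ Q.faces) :
    ∃ ε, IsOriented F ε (Q.corner F 0) (Q.corner F 1) (Q.corner F 2) (Q.corner F 3) :=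
  (Q.corner_spec hF).isSimpleQuad.exists_isOriented (isOpen_face hF) hF.1 (face_nonempty hF)
    (Q.corner_spec hF).frontier_eq_polygon

/-- The sign of the orientation of a face with respect to the listing of its vertices. -/
def sgn (F : Set ℂ) : ℝ := Classical.epsilon fun ε =>
  IsOriented F ε (Q.corner F 0) (Q.corner F 1) (Q.corner F 2) (Q.corner F 3)

lemma isOriented (hF : F ∈ Q.faces) :
    IsOriented F (Q.sgn F) (Q.corner F 0) (Q.corner F 1) (Q.corner F 2) (Q.corner F 3) :=
  Classical.epsilon_spec (Q.exists_sgn hF)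

lemma side (hF : F ∈ Q.faces) (i : Fin 4) {m : ℂ}
    (hm : m ∈ openSegment ℝ (Q.corner F i) (Q.corner F (i + 1))) :
    ∀ᶠ p in 𝓝 m, p ∈ F → 0 ≤ Q.sgn F * ori (Q.corner F i) (Q.corner F (i + 1)) p := by
  have h := Q.isOriented hF
  fin_cases i
  · exact h.side₁ m hm
  · exact h.side₂ m hm
  · exact h.side₃ m hm
  · exact h.side₄ m hm

/-- Distinct faces share at most an edge, and an edge contains only two vertices. -/
lemma face_eq_of_corners (hF : F ∈ Q.faces) (hG : G ∈ Q.faces) {p q r : ℂ}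
    (hpq : p ≠ q) (hpr : p ≠ r) (hqr : q ≠ r)
    (hFc : ∀ x ∈ ({p, q, r} : Set ℂ), ∃ i, Q.corner F i = x)
    (hGc : ∀ x ∈ ({p, q, r} : Set ℂ), ∃ i, Q.corner G i = x) : F = G := by
  by_contra hne
  have hmem : ∀ x ∈ ({p, q, r} : Set ℂ), x ∈ closure F ∩ closure G ∧ x ∈ Q.verts := by
    intro x hx
    obtain ⟨i, hi⟩ := hFc x hx
    obtain ⟨j, hj⟩ := hGc x hx
    refine ⟨⟨?_, ?_⟩, ?_⟩
    · exact hi ▸ (Q.corner_spec hF).vert_mem_closure i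
    · exact hj ▸ (Q.corner_spec hG).vert_mem_closure j
    · exact hi ▸ (Q.corner_spec hF).vert_mem i
  obtain ⟨hp, hpv⟩ := hmem p (by simp)
  obtain ⟨hq, hqv⟩ := hmem q (by simp)
  obtain ⟨hr, hrv⟩ := hmem r (by simp)
  rcases Q.face_face F hF G hG hne with h | ⟨v, _, h⟩ | ⟨a, b, hab, h⟩
  · rw [h] at hp; exact hp
  · rw [h] at hp hq
    exact hpq (hp.trans hq.symm)
  · rw [h] at hp hq hr
    have h1 := Q.vert_edge a b p hab hpv hp
    have h2 := Q.vert_edge a b q hab hqv hq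
    have h3 := Q.vert_edge a b r hab hrv hr
    grind

lemma face_eq_of_corner_eq (hF : F ∈ Q.faces) (hG : G ∈ Q.faces) (i : Fin 4)
    (h0 : Q.corner F i = Q.corner G i) (h1 : Q.corner F (i + 1) = Q.corner G (i + 1))
    (h2 : Q.corner F (i + 2) = Q.corner G (i + 2)) : F = G := by
  have hi := (Q.corner_spec hF).injective
  refine Q.face_eq_of_corners hF hG (p := Q.corner F i) (q := Q.corner F (i + 1))
    (r := Q.corner F (i + 2)) (hi.ne (by clear * -; revert i; decide)) (hi.ne (by clear * -; revert i; decide))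
    (hi.ne (by clear * -; revert i; decide)) ?_ ?_
  · rintro x (rfl | rfl | rfl) <;> exact ⟨_, rfl⟩
  · rintro x (rfl | rfl | rfl)
    exacts [⟨_, h0.symm⟩, ⟨_, h1.symm⟩, ⟨_, h2.symm⟩]

lemma finite_faces : Q.faces.Finite := by
  refine Set.Finite.of_finite_image (f := Q.corner)
    ((Fintype.piFinset fun _ : Fin 4 => Q.verts).finite_toSet.subset ?_) ?_
  · rintro _ ⟨F, hF, rfl⟩
    simpa using (Q.corner_spec hF).vert_mem
  · intro F hF G hG e
    exact Q.face_eq_of_corner_eq hF hG 0 (by rw [e]) (by rw [e]) (by rw [e])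

/-- The finite set of bounded faces. -/
def faceFinset : Finset (Set ℂ) := Q.finite_faces.toFinset

lemma mem_faceFinset : F ∈ Q.faceFinset ↔ F ∈ Q.faces := by simp [faceFinset]

/-- The sides of a face, directed so that the face lies to the left. -/
def posSide (x : Set ℂ × Fin 4) : ℂ × ℂ :=
  if Q.sgn x.1 = 1 then (Q.corner x.1 x.2, Q.corner x.1 (x.2 + 1))
  else (Q.corner x.1 (x.2 + 1), Q.corner x.1 x.2)

lemma posSide_adj (hF : F ∈ Q.faces) (i : Fin 4) :
    Q.graph.Adj (Q.posSide (F, i)).1 (Q.posSide (F, i)).2 := by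
  unfold posSide
  split_ifs
  · exact (Q.corner_spec hF).adj i
  · exact ((Q.corner_spec hF).adj i).symm

lemma posSide_side (hF : F ∈ Q.faces) (i : Fin 4) {m : ℂ}
    (hm : m ∈ openSegment ℝ (Q.posSide (F, i)).1 (Q.posSide (F, i)).2) :
    ∀ᶠ p in 𝓝 m, p ∈ F → 0 ≤ ori (Q.posSide (F, i)).1 (Q.posSide (F, i)).2 p := by
  unfold posSide at *
  split_ifs at * with h
  · filter_upwards [Q.side hF i hm] with p hp hpF
    simpa [show Q.sgn F = 1 from h] using hp hpF
  · have h' : Q.sgn F = -1 := (Q.isOriented hF).sign.resolve_left h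
    rw [openSegment_symm] at hm
    filter_upwards [Q.side hF i hm] with p hp hpF
    rw [ori_swap]
    simpa [h'] using hp hpF

/-- A small half-disk avoids the graph and is connected, so it suffices that it meets `F`. It does,
since `F` accumulates at `m`, lies weakly to the left of `ab` there and misses the edge itself. -/
lemma halfDisk_subset (hF : F ∈ Q.faces) (i : Fin 4) {a b m : ℂ} (he : Q.posSide (F, i) = (a, b))
    (hm : m ∈ openSegment ℝ a b) : ∃ δ > 0, halfDisk a b m δ ⊆ F := by
  have hab : Q.graph.Adj a b := by simpa [he] using Q.posSide_adj hF i
  have hside : ∀ᶠ p in 𝓝 m, p ∈ F → 0 ≤ ori a b p := by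
    have := Q.posSide_side hF i (m := m) (by simpa [he] using hm)
    simpa [he] using this
  obtain ⟨δ, hδ, hball⟩ := Metric.eventually_nhds_iff_ball.1
    (hside.and (eventually_mem_edge hab hm))
  refine ⟨δ, hδ, subset_face hF (isPreconnected_halfDisk a b m δ) ?_ ?_⟩
  · rw [Set.disjoint_left]
    rintro p ⟨hp, hp0⟩ hpQ
    exact hp0.ne' ((hball p hp).2.1 hpQ)
  · have hmF : m ∈ closure F := by
      refine frontier_subset_closure ?_
      rw [(Q.corner_spec hF).frontier_eq]
      refine mem_iUnion.2 ⟨i, ?_⟩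
      have := openSegment_subset_segment _ _ _ hm
      unfold posSide at he
      split_ifs at he <;> obtain ⟨rfl, rfl⟩ := Prod.mk.inj he
      · exact this
      · rwa [segment_symm]
    obtain ⟨p, hpF, hpm⟩ := Metric.mem_closure_iff.1 hmF δ hδ
    rw [dist_comm] at hpm
    have hp := hball p hpm
    refine ⟨p, ⟨hpm, (hp.1 hpF).lt_of_ne' fun h0 => ?_⟩, hpF⟩
    exact face_subset hF hpF (hp.2.2 h0)

/-- Two faces to the left of the same directed edge contain a common half-disk, hence coincide. -/
lemma injOn_posSide : Set.InjOn Q.posSide {x | x.1 ∈ Q.faces} := by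
  rintro ⟨F, i⟩ hF ⟨G, j⟩ hG he
  simp only [mem_ofPred_eq] at hF hG
  have hab := Q.posSide_adj hF i
  obtain ⟨a, b, hFe⟩ : ∃ a b, Q.posSide (F, i) = (a, b) := ⟨_, _, rfl⟩
  have hGe := he.symm.trans hFe
  rw [hFe] at hab
  have hm : midpoint ℝ a b ∈ openSegment ℝ a b := midpoint_mem_openSegment a b
  obtain ⟨δ, hδ, h1⟩ := Q.halfDisk_subset hF i hFe hm
  obtain ⟨δ', hδ', h2⟩ := Q.halfDisk_subset hG j hGe hm
  have hne : (halfDisk a b (midpoint ℝ a b) (min δ δ')).Nonempty := closure_nonempty_iff.1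
    ⟨_, mem_closure_halfDisk (lt_min hδ hδ') hab.ne
      (ori_eq_zero_of_mem_segment (openSegment_subset_segment _ _ _ hm))⟩
  obtain rfl : F = G := by
    refine face_eq hF hG (hne.mono fun p hp => ⟨h1 ⟨?_, hp.2⟩, h2 ⟨?_, hp.2⟩⟩)
    · exact Metric.ball_subset_ball (min_le_left _ _) hp.1
    · exact Metric.ball_subset_ball (min_le_right _ _) hp.1
  have hi := (Q.corner_spec hF).injective
  rw [Prod.mk.injEq]
  refine ⟨rfl, ?_⟩
  unfold posSide at he
  split_ifs at he
  · exact hi (Prod.mk.inj he).1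
  · exact hi (Prod.mk.inj he).2

/-- The edge has an inner point `m` in the open set `Q.inside`, so the left half-disk at `m` lies in
a bounded face. Its frontier contains `m`, so the edge is one of its sides; the opposite direction
would force the face to the right of `ab`. -/
lemma exists_posSide {a b : ℂ} (hab : Q.graph.Adj a b) (hin : a ∈ Q.inside ∨ b ∈ Q.inside) :
    ∃ F ∈ Q.faces, ∃ i, Q.posSide (F, i) = (a, b) := by
  obtain ⟨m, hmi, hm⟩ : ∃ m ∈ Q.inside, m ∈ openSegment ℝ a b := by
    have hcl : closure (openSegment ℝ a b) = segment ℝ a b := closure_openSegment a b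
    rcases hin with h | h
    · exact mem_closure_iff.1 (hcl ▸ left_mem_segment ℝ a b) _ Q.isOpen_inside h
    · exact mem_closure_iff.1 (hcl ▸ right_mem_segment ℝ a b) _ Q.isOpen_inside h
  have hms := openSegment_subset_segment _ _ _ hm
  have hm0 := ori_eq_zero_of_mem_segment hms
  obtain ⟨δ, hδ, hball⟩ := Metric.eventually_nhds_iff_ball.1 (eventually_mem_edge hab hm)
  have hcl := mem_closure_halfDisk hδ hab.ne hm0
  obtain ⟨p, hp⟩ := closure_nonempty_iff.1 ⟨m, hcl⟩
  obtain ⟨F, hF, hsub⟩ := exists_face (isPreconnected_halfDisk a b m δ)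
    (by
      rw [Set.disjoint_left]
      rintro p ⟨hp, hp0⟩ hpQ
      exact hp0.ne' ((hball p hp).1 hpQ)) hp ⟨m, hmi, hcl⟩
  have hmF : m ∈ frontier F := by
    rw [(isOpen_face hF).frontier_eq]
    exact ⟨closure_mono hsub hcl, fun h => face_subset hF h (Or.inr ⟨a, b, hab, hms⟩)⟩
  have hq := Q.corner_spec hF
  rw [hq.frontier_eq] at hmF
  obtain ⟨i, hi⟩ := mem_iUnion.1 hmF
  have hs : s(a, b) = s(Q.corner F i, Q.corner F (i + 1)) := by
    by_contra hne
    rcases (Q.edge_edge _ _ _ _ hab (hq.adj i) hne ⟨hms, hi⟩).1 with rfl | h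
    · exact hab.ne (left_mem_openSegment_iff.1 hm)
    · rw [mem_singleton_iff] at h
      subst h
      exact hab.ne (right_mem_openSegment_iff.1 hm)
  refine ⟨F, hF, i, ?_⟩
  have hpos : Q.posSide (F, i) = (a, b) ∨ Q.posSide (F, i) = (b, a) := by
    rw [Sym2.eq_iff] at hs
    unfold posSide
    split_ifs <;> rcases hs with ⟨rfl, rfl⟩ | ⟨rfl, rfl⟩ <;> simp
  refine hpos.resolve_right fun hba => ?_
  have hside := Q.posSide_side hF i (m := m) (by rwa [hba, openSegment_symm])
  rw [hba] at hside
  obtain ⟨δ', hδ', hball'⟩ := Metric.eventually_nhds_iff_ball.1 hside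
  obtain ⟨q, hq⟩ := closure_nonempty_iff.1
    ⟨m, mem_closure_halfDisk (lt_min hδ hδ') hab.ne hm0⟩
  have h1 := hball' q (Metric.ball_subset_ball (min_le_right _ _) hq.1)
    (hsub ⟨Metric.ball_subset_ball (min_le_left _ _) hq.1, hq.2⟩)
  rw [ori_swap] at h1
  have h2 : 0 < ori a b q := hq.2
  linarith

/-- The contributions of the edges cancel in a sum over the oriented boundaries of all faces. -/
lemma sum_side_eq_zero (w : ℂ → ℂ → ℝ) (hw : ∀ a b, w b a = -w a b)
    (hin : ∀ a b, w a b ≠ 0 → a ∈ Q.inside ∨ b ∈ Q.inside) :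
    ∑ F ∈ Q.faceFinset, Q.sgn F * ∑ i, w (Q.corner F i) (Q.corner F (i + 1)) = 0 := by
  classical
  have h1 : ∀ F ∈ Q.faceFinset, Q.sgn F * ∑ i, w (Q.corner F i) (Q.corner F (i + 1)) =
      ∑ i, w (Q.posSide (F, i)).1 (Q.posSide (F, i)).2 := by
    intro F hF
    rw [Finset.mul_sum]
    refine Finset.sum_congr rfl fun i _ => ?_
    unfold posSide
    split_ifs with h
    · simp [show Q.sgn F = 1 from h]
    · have h' : Q.sgn F = -1 := (Q.isOriented (Q.mem_faceFinset.1 hF)).sign.resolve_left h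
      rw [h', hw]; ring
  rw [Finset.sum_congr rfl h1, ← Finset.sum_product',
    ← Finset.sum_image (f := fun e : ℂ × ℂ => w e.1 e.2) (g := Q.posSide), ← Finset.sum_filter_ne_zero]
  swap
  · intro x hx y hy
    rw [Finset.mem_coe, Finset.mem_product] at hx hy
    exact Q.injOn_posSide (Q.mem_faceFinset.1 hx.1) (Q.mem_faceFinset.1 hy.1)
  -- The sum now runs over directed edges of nonzero weight. Each has an end inside, so its reverse
  -- is also a directed side of some face and the two weights cancel.
  refine Finset.sum_involution (fun e _ => e.swap) ?_ ?_ ?_ ?_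
  · rintro ⟨a, b⟩ _
    simp [hw a b]
  · rintro ⟨a, b⟩ _ h0 h
    simp only [Prod.swap_prod_mk, Prod.mk.injEq] at h
    obtain ⟨rfl, _⟩ := h
    have := hw b b
    apply h0
    simp only
    linarith
  · rintro ⟨a, b⟩ he
    simp only [Finset.mem_filter, Finset.mem_image, Finset.mem_product, Finset.mem_univ, and_true,
      mem_faceFinset] at he
    obtain ⟨⟨⟨F, i⟩, hF, he⟩, h0⟩ := he
    have hab : Q.graph.Adj a b := by simpa [he] using Q.posSide_adj hF i
    have h0' : w b a ≠ 0 := by rw [hw]; simpa using h0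
    obtain ⟨G, hG, j, hj⟩ := Q.exists_posSide hab.symm (hin _ _ h0')
    simp only [Finset.mem_filter, Finset.mem_image, Finset.mem_product, Finset.mem_univ, and_true,
      mem_faceFinset]
    exact ⟨⟨(G, j), hG, hj⟩, h0'⟩
  · rintro ⟨a, b⟩ _
    rfl

end QuadLattice

/-! ### The discrete gradient, the laplacian and summation by parts. -/

lemma real_inner_eq (v w : ℂ) : inner ℝ v w = v.re * w.re + v.im * w.im := by
  rw [Complex.inner]; simp [Complex.mul_re]; ring

lemma abs_cross_eq (v w : ℂ) :
    |cross v w| = Real.sin (InnerProductGeometry.angle v w) * (‖v‖ * ‖w‖) := by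
  rw [InnerProductGeometry.sin_angle_mul_norm_mul_norm, ← Real.sqrt_sq_eq_abs]
  congr 1
  simp only [real_inner_eq, cross]; ring

/-- A vector is controlled by its components along two vectors forming an angle away from
`0` and `π`. -/
lemma norm_le_of_inner_le {v d₁ d₂ : ℂ} {K m : ℝ} (hK : 0 < K)
    (h₁ : d₁ ≠ 0) (h₂ : d₂ ≠ 0)
    (ha : 1 / K < InnerProductGeometry.angle d₁ d₂)
    (hb : 1 / K < Real.pi - InnerProductGeometry.angle d₁ d₂)
    (hv₁ : |inner ℝ v d₁| ≤ m * ‖d₁‖) (hv₂ : |inner ℝ v d₂| ≤ m * ‖d₂‖) : ‖v‖ ≤ 4 * K * m := by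
  set θ := InnerProductGeometry.angle d₁ d₂
  have n1 := norm_pos_iff.2 h₁
  have n2 := norm_pos_iff.2 h₂
  have hK' : 0 < 1 / K := by positivity
  -- Jordan's inequality `sin t ≥ 2t/π`, together with `π ≤ 4`.
  have hsin : 1 / (2 * K) ≤ Real.sin θ := by
    have key : ∀ t : ℝ, 1 / K < t → t ≤ Real.pi / 2 → 1 / (2 * K) ≤ Real.sin t := by
      intro t h1 h2
      have h3 := Real.mul_le_sin (by linarith) h2
      refine le_trans ?_ h3
      have h4 : (1 : ℝ) / 2 ≤ 2 / Real.pi := by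
        rw [div_le_div_iff₀ (by norm_num) Real.pi_pos]
        linarith [Real.pi_le_four]
      calc 1 / (2 * K) = 1 / 2 * (1 / K) := by field_simp
        _ ≤ 2 / Real.pi * t := by gcongr
    rcases le_total θ (Real.pi / 2) with h | h
    · exact key θ ha h
    · rw [← Real.sin_pi_sub]
      exact key _ hb (by linarith)
  have hX : |cross d₁ d₂| * ‖v‖ ≤ 2 * m * (‖d₁‖ * ‖d₂‖) := by
    have e : (cross d₁ d₂ : ℂ) * v = (inner ℝ v d₁ : ℝ) * (-Complex.I * d₂) +
        (inner ℝ v d₂ : ℝ) * (Complex.I * d₁) := by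
      apply Complex.ext <;> simp [cross] <;> ring
    calc |cross d₁ d₂| * ‖v‖ = ‖(cross d₁ d₂ : ℂ) * v‖ := by simp
      _ ≤ |inner ℝ v d₁| * ‖d₂‖ + |inner ℝ v d₂| * ‖d₁‖ := by
        rw [e]; refine (norm_add_le _ _).trans ?_
        rw [norm_mul, norm_mul, norm_mul, norm_mul]
        simp only [norm_neg, Complex.norm_I, one_mul, Complex.norm_real, Real.norm_eq_abs, le_refl]
      _ ≤ m * ‖d₁‖ * ‖d₂‖ + m * ‖d₂‖ * ‖d₁‖ := by gcongr
      _ = _ := by ring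
  rw [abs_cross_eq] at hX
  have h5 : 1 / (2 * K) * (‖d₁‖ * ‖d₂‖) * ‖v‖ ≤ 2 * m * (‖d₁‖ * ‖d₂‖) :=
    le_trans (by gcongr) hX
  have h6 : 0 < ‖d₁‖ * ‖d₂‖ := by positivity
  have h7 : 1 / (2 * K) * ‖v‖ ≤ 2 * m := by
    refine le_of_mul_le_mul_right ?_ h6
    calc _ = 1 / (2 * K) * (‖d₁‖ * ‖d₂‖) * ‖v‖ := by ring
      _ ≤ _ := h5
  calc ‖v‖ = 2 * K * (1 / (2 * K) * ‖v‖) := by field_simp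
    _ ≤ 2 * K * (2 * m) := by gcongr
    _ = _ := by ring

namespace QuadLattice

open PlaneGraph

variable (Q : QuadLattice) {F : Set ℂ}

/-- Twice the signed area of a face. -/
def signedArea (F : Set ℂ) : ℝ := cross (Q.diag₁ F) (Q.diag₂ F)

lemma sgn_mul_signedArea_pos (hF : F ∈ Q.faces) : 0 < Q.sgn F * Q.signedArea F :=
  (Q.isOriented hF).pos

lemma signedArea_ne_zero (hF : F ∈ Q.faces) : Q.signedArea F ≠ 0 :=
  right_ne_zero_of_mul (Q.sgn_mul_signedArea_pos hF).ne'

lemma volume_face (hF : F ∈ Q.faces) :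
    (volume F).toReal = Q.sgn F * Q.signedArea F / 2 := by
  have h := (Q.isOriented hF).volume_eq
  rw [h, ENNReal.toReal_ofReal]
  · rfl
  · have := Q.sgn_mul_signedArea_pos hF
    exact div_nonneg this.le (by norm_num)

/-- The vector `∑ᵢ (u(zᵢ) + u(zᵢ₊₁)) nᵢ`, where `nᵢ` is the normal to the side `zᵢzᵢ₊₁`. -/
def conormal (F : Set ℂ) : (ℂ → ℝ) →ₗ[ℝ] ℂ where
  toFun u := (u (Q.corner F 2) - u (Q.corner F 0)) • (-Complex.I * Q.diag₂ F) +
    (u (Q.corner F 3) - u (Q.corner F 1)) • (Complex.I * Q.diag₁ F)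
  map_add' u v := by simp only [Pi.add_apply]; module
  map_smul' s u := by simp only [Pi.smul_apply, smul_eq_mul, RingHom.id_apply]; module

lemma conormal_apply (F : Set ℂ) (u : ℂ → ℝ) : Q.conormal F u =
    (u (Q.corner F 2) - u (Q.corner F 0)) • (-Complex.I * Q.diag₂ F) +
    (u (Q.corner F 3) - u (Q.corner F 1)) • (Complex.I * Q.diag₁ F) := rfl

/-- The side-by-side form of the conormal, needed to compare it with quantities that cancel between
neighbouring faces. -/
lemma conormal_eq_sum (F : Set ℂ) (u : ℂ → ℝ) : Q.conormal F u =
    ∑ i, (u (Q.corner F i) + u (Q.corner F (i + 1))) •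
      (-Complex.I * (Q.corner F (i + 1) - Q.corner F i)) := by
  rw [conormal_apply, Fin.sum_univ_four]
  simp only [diag₁, diag₂, Complex.real_smul, Fin.isValue, zero_add, Fin.reduceAdd]
  push_cast
  ring

/-- Cramer's rule for the two equations along the diagonals; the determinant is twice the signed
area. -/
lemma isGradient_iff (hF : F ∈ Q.faces) (u : ℂ → ℝ) (v : ℂ) :
    Q.IsGradient u F v ↔ v = (Q.signedArea F)⁻¹ • Q.conormal F u := by
  have hX := Q.signedArea_ne_zero hF
  rw [conormal_apply]
  unfold IsGradient signedArea at *
  set d₁ := Q.diag₁ F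
  set d₂ := Q.diag₂ F
  rw [eq_inv_smul_iff₀ hX]
  constructor
  · rintro ⟨h1, h2⟩
    rw [← h1, ← h2]
    apply Complex.ext <;> simp [cross] <;> ring
  · intro h
    have hr := congrArg Complex.re h
    have hi := congrArg Complex.im h
    simp at hr hi
    constructor
    · apply mul_left_cancel₀ hX
      rw [real_inner_eq]
      simp only [cross] at hr hi ⊢
      linear_combination d₁.re * hr + d₁.im * hi
    · apply mul_left_cancel₀ hX
      rw [real_inner_eq]
      simp only [cross] at hr hi ⊢
      linear_combination d₂.re * hr + d₂.im * hi

lemma grad_eq (hF : F ∈ Q.faces) (u : ℂ → ℝ) :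
    Q.grad u F = (Q.signedArea F)⁻¹ • Q.conormal F u :=
  (Q.isGradient_iff hF u _).1 (Classical.epsilon_spec ⟨_, (Q.isGradient_iff hF u _).2 rfl⟩)

lemma isGradient_grad (hF : F ∈ Q.faces) (u : ℂ → ℝ) : Q.IsGradient u F (Q.grad u F) :=
  (Q.isGradient_iff hF u _).2 (Q.grad_eq hF u)

lemma energy_eq (u : ℂ → ℝ) : Q.energy u =
    ∑ F ∈ Q.faceFinset, ‖Q.grad u F‖ ^ 2 * (Q.sgn F * Q.signedArea F / 2) := by
  rw [energy, finsum_mem_eq_finite_toFinset_sum _ Q.finite_faces]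
  exact Finset.sum_congr rfl fun F hF => by rw [Q.volume_face (Q.finite_faces.mem_toFinset.1 hF)]

-- As a function of the value at `z` the energy is a quadratic polynomial. The area factor
-- disappears because the conormal is the gradient times `signedArea`.
open scoped Classical in
lemma laplacian_eq (u : ℂ → ℝ) (z : ℂ) : Q.laplacian u z =
    -∑ F ∈ Q.faceFinset, Q.sgn F * inner ℝ (Q.grad u F) (Q.conormal F (Pi.single z 1)) := by
  rw [laplacian]
  congr 1
  simp_rw [energy_eq]
  refine HasDerivAt.deriv (HasDerivAt.fun_sum fun F hF => ?_)
  have hF' := Q.mem_faceFinset.1 hF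
  have hX := Q.signedArea_ne_zero hF'
  have hu : ∀ t : ℝ, Function.update u z t = u + (t - u z) • (Pi.single z 1 : ℂ → ℝ) := by
    intro t
    ext w
    by_cases hw : w = z
    · subst hw; simp
    · simp [hw]
  set b := Q.grad (Pi.single z 1) F with hb
  have hg : ∀ t : ℝ, ‖Q.grad (Function.update u z t) F‖ ^ 2 =
      ‖Q.grad u F‖ ^ 2 + 2 * ((t - u z) * inner ℝ (Q.grad u F) b) + (t - u z) ^ 2 * ‖b‖ ^ 2 := by
    intro t
    have : Q.grad (Function.update u z t) F = Q.grad u F + (t - u z) • b := by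
      rw [hb, Q.grad_eq hF', Q.grad_eq hF', Q.grad_eq hF', hu, map_add, map_smul]
      module
    rw [this, norm_add_sq_real, inner_smul_right, norm_smul, mul_pow, Real.norm_eq_abs, sq_abs]
  have hN : Q.conormal F (Pi.single z 1) = Q.signedArea F • b := by
    rw [hb, Q.grad_eq hF', smul_inv_smul₀ hX]
  simp_rw [hg]
  have h1 : HasDerivAt (fun t : ℝ => t - u z) 1 (u z) := (hasDerivAt_id _).sub_const _
  have h2 := ((((h1.mul_const (inner ℝ (Q.grad u F) b)).const_mul 2).const_add
    (‖Q.grad u F‖ ^ 2)).add ((h1.pow 2).mul_const (‖b‖ ^ 2))).mul_const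
      (Q.sgn F * Q.signedArea F / 2)
  refine h2.congr_deriv ?_
  rw [hN, inner_smul_right]
  simp; ring

-- The conormal is linear in the function, so the point masses on `T` add up to its indicator.
open scoped Classical in
lemma sum_laplacian (u : ℂ → ℝ) (T : Finset ℂ) : ∑ z ∈ T, Q.laplacian u z =
    -∑ F ∈ Q.faceFinset, Q.sgn F *
      inner ℝ (Q.grad u F) (Q.conormal F ((T : Set ℂ).indicator 1)) := by
  simp_rw [laplacian_eq]
  rw [Finset.sum_neg_distrib, Finset.sum_comm]
  congr 1
  refine Finset.sum_congr rfl fun F _ => ?_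
  have : ((T : Set ℂ).indicator 1 : ℂ → ℝ) = ∑ z ∈ T, Pi.single z 1 := by
    ext w
    simp [Set.indicator_apply, Finset.sum_apply, Pi.single_apply]
  rw [this, map_sum, inner_sum, Finset.mul_sum]

lemma diag₁_ne_zero (hF : F ∈ Q.faces) : Q.diag₁ F ≠ 0 :=
  sub_ne_zero.2 ((Q.corner_spec hF).injective.ne (by decide))

lemma diag₂_ne_zero (hF : F ∈ Q.faces) : Q.diag₂ F ≠ 0 :=
  sub_ne_zero.2 ((Q.corner_spec hF).injective.ne (by decide))

lemma norm_diag₁_le (hF : F ∈ Q.faces) : ‖Q.diag₁ F‖ ≤ Q.h := by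
  rw [diag₁, ← dist_eq_norm]; exact (Q.corner_spec hF).dist_le _ _

lemma norm_diag₂_le (hF : F ∈ Q.faces) : ‖Q.diag₂ F‖ ≤ Q.h := by
  rw [diag₂, ← dist_eq_norm]; exact (Q.corner_spec hF).dist_le _ _

/-- The discrete gradient is close to a vector which approximates the differential. -/
lemma norm_grad_sub_le (hF : F ∈ Q.faces) {K m : ℝ} (hK : 0 < K) (hD : Q.CondD K)
    {u : ℂ → ℝ} (hu : Differentiable ℝ u) {S : Set ℂ} (hS : Convex ℝ S)
    (hSF : ∀ i, Q.corner F i ∈ S) {v : ℂ} (hv : ∀ x ∈ S, ‖fderiv ℝ u x - innerSL ℝ v‖ ≤ m) :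
    ‖Q.grad u F - v‖ ≤ 4 * K * m := by
  obtain ⟨-, -, ha, hb⟩ := hD F hF
  obtain ⟨g1, g2⟩ := Q.isGradient_grad hF u
  -- Mean value inequality for `u` minus a linear function along the segment between two corners. A
  -- diagonal may leave a nonconvex face, hence the convex set `S`.
  have key : ∀ i j, |u (Q.corner F i) - u (Q.corner F j) -
      inner ℝ v (Q.corner F i - Q.corner F j)| ≤ m * ‖Q.corner F i - Q.corner F j‖ := by
    intro i j
    have := hS.norm_image_sub_le_of_norm_hasFDerivWithin_le (𝕜 := ℝ)
      (f := fun x => u x - innerSL ℝ v x) (f' := fun x => fderiv ℝ u x - innerSL ℝ v) (C := m)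
      (fun x hx => ((hu x).hasFDerivAt.sub (innerSL ℝ v).hasFDerivAt).hasFDerivWithinAt)
      hv (hSF j) (hSF i)
    rw [Real.norm_eq_abs] at this
    convert this using 2
    rw [inner_sub_right]; simp; ring
  refine norm_le_of_inner_le hK (Q.diag₁_ne_zero hF) (Q.diag₂_ne_zero hF) ha hb ?_ ?_
  · rw [inner_sub_left, g1]; exact key 2 0
  · rw [inner_sub_left, g2]; exact key 3 1

end QuadLattice

/-! ### Affine fields and the error at a single face. -/

/-- An affine vector field with symmetric linear part. -/
def affineField (l : ℂ) (a b d : ℝ) (c p : ℂ) : ℂ :=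
  ⟨l.re + a * (p - c).re + b * (p - c).im, l.im + b * (p - c).re + d * (p - c).im⟩

lemma norm_affineField_sub_le {l : ℂ} {a b d M : ℝ} {c : ℂ} (ha : |a| ≤ M) (hb : |b| ≤ M)
    (hd : |d| ≤ M) (p q : ℂ) :
    ‖affineField l a b d c p - affineField l a b d c q‖ ≤ 4 * M * ‖p - q‖ := by
  have h1 := Complex.abs_re_le_norm (p - q)
  have h2 := Complex.abs_im_le_norm (p - q)
  have key : ∀ s t : ℝ, |s| ≤ M → |t| ≤ M →
      |s * (p - q).re + t * (p - q).im| ≤ 2 * M * ‖p - q‖ := by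
    intro s t hs ht
    have hM : 0 ≤ M := (abs_nonneg _).trans hs
    calc _ ≤ |s| * |(p - q).re| + |t| * |(p - q).im| := by
          refine (abs_add_le _ _).trans ?_; rw [abs_mul, abs_mul]
      _ ≤ M * ‖p - q‖ + M * ‖p - q‖ := by gcongr
      _ = _ := by ring
  refine (Complex.norm_le_abs_re_add_abs_im _).trans ?_
  have e1 := key a b ha hb
  have e2 := key b d hb hd
  have f1 : (affineField l a b d c p - affineField l a b d c q).re =
      a * (p - q).re + b * (p - q).im := by simp [affineField]; ring
  have f2 : (affineField l a b d c p - affineField l a b d c q).im =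
      b * (p - q).re + d * (p - q).im := by simp [affineField]; ring
  rw [f1, f2]; linarith

namespace QuadLattice

open PlaneGraph

variable (Q : QuadLattice) {F : Set ℂ}

/-- The flux of an affine field through the boundary of a quadrilateral. -/
lemma sum_flux (F : Set ℂ) (l : ℂ) (a b d : ℝ) (c : ℂ) :
    ∑ i, inner ℝ (affineField l a b d c ((Q.corner F i + Q.corner F (i + 1)) / 2))
      (-Complex.I * (Q.corner F (i + 1) - Q.corner F i)) = (a + d) * Q.signedArea F / 2 := by
  rw [Fin.sum_univ_four]
  have e : ∀ x y : ℂ, ((x + y) / 2).re = (x.re + y.re) / 2 ∧ ((x + y) / 2).im = (x.im + y.im) / 2 :=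
    fun x y => by simp
  simp only [real_inner_eq, affineField, signedArea, cross, diag₁, diag₂, Fin.isValue, zero_add,
    Fin.reduceAdd, Complex.sub_re, Complex.sub_im, (e _ _).1, (e _ _).2, Complex.mul_re,
    Complex.mul_im, Complex.neg_re, Complex.neg_im, Complex.I_re, Complex.I_im]
  ring

variable {B : Finset ℂ}

/-- Adjacent corners have different colors, so at most one of them is in `T`. -/
lemma indicator_corner (hB : Q.IsColorClass B) (hF : F ∈ Q.faces) (T : Finset ℂ) (hT : T ⊆ B)
    (i : Fin 4) : |(T : Set ℂ).indicator (1 : ℂ → ℝ) (Q.corner F i) +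
      (T : Set ℂ).indicator (1 : ℂ → ℝ) (Q.corner F (i + 1))| ≤ 1 := by
  have key : Q.corner F i ∉ T ∨ Q.corner F (i + 1) ∉ T := by
    have := hB.2 F hF
    by_contra! h
    have h1 := hT h.1
    have h2 := hT h.2
    fin_cases i <;> simp at h1 h2 <;> tauto
  classical
  rw [Set.indicator_apply, Set.indicator_apply]
  simp only [Finset.mem_coe, Pi.one_apply]
  rcases key with h | h <;> rw [if_neg h] <;> split_ifs <;> simp

/-- The indicator vanishes at the ends of one diagonal, which leaves one term: a difference of size
at most 1 times a diagonal. -/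
lemma norm_conormal_le (hB : Q.IsColorClass B) (hF : F ∈ Q.faces) (T : Finset ℂ) (hT : T ⊆ B) :
    ‖Q.conormal F ((T : Set ℂ).indicator 1)‖ ≤ Q.h := by
  classical
  have h1 := Q.norm_diag₁_le hF
  have h2 := Q.norm_diag₂_le hF
  have key : ∀ x y : ℂ, |(T : Set ℂ).indicator (1 : ℂ → ℝ) x -
      (T : Set ℂ).indicator (1 : ℂ → ℝ) y| ≤ 1 := by
    intro x y
    rw [Set.indicator_apply, Set.indicator_apply]
    split_ifs <;> simp
  have h0 : ∀ x, x ∉ B → (T : Set ℂ).indicator (1 : ℂ → ℝ) x = 0 := fun x hx =>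
    indicator_of_notMem (fun h => hx (hT h)) _
  rw [conormal_apply]
  rcases hB.2 F hF with ⟨-, -, e1, e2⟩ | ⟨-, -, e1, e2⟩ <;> rw [h0 _ e1, h0 _ e2]
  · simp only [sub_self, zero_smul, add_zero, norm_smul, norm_mul, norm_neg, Complex.norm_I,
      one_mul, Real.norm_eq_abs]
    exact (mul_le_of_le_one_left (norm_nonneg _) (key _ _)).trans h2
  · simp only [sub_self, zero_smul, zero_add, norm_smul, norm_mul, Complex.norm_I,
      one_mul, Real.norm_eq_abs]
    exact (mul_le_of_le_one_left (norm_nonneg _) (key _ _)).trans h1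

/-- The error made at one face when the discrete gradient is replaced by an affine field. -/
lemma face_error (hB : Q.IsColorClass B) (hF : F ∈ Q.faces) (T : Finset ℂ) (hT : T ⊆ B)
    {K m M : ℝ} (hK : 0 < K) (hm : 0 ≤ m) {l : ℂ} {a b d : ℝ} {c : ℂ}
    (ha : |a| ≤ M) (hb : |b| ≤ M) (hd : |d| ≤ M) (hD : Q.CondD K)
    {u : ℂ → ℝ} (hu : Differentiable ℝ u) {S : Set ℂ} (hS : Convex ℝ S)
    (hSF : ∀ i, Q.corner F i ∈ S)
    (hv : ∀ x ∈ S, ‖fderiv ℝ u x - innerSL ℝ (affineField l a b d c x)‖ ≤ m) :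
    |inner ℝ (Q.grad u F) (Q.conormal F ((T : Set ℂ).indicator 1)) -
      ∑ i, ((T : Set ℂ).indicator (1 : ℂ → ℝ) (Q.corner F i) +
        (T : Set ℂ).indicator (1 : ℂ → ℝ) (Q.corner F (i + 1))) *
        inner ℝ (affineField l a b d c ((Q.corner F i + Q.corner F (i + 1)) / 2))
          (-Complex.I * (Q.corner F (i + 1) - Q.corner F i))| ≤
      4 * K * (m + 4 * M * Q.h) * Q.h + 16 * M * Q.h ^ 2 := by
  set W := affineField l a b d c
  set χ : ℂ → ℝ := (T : Set ℂ).indicator 1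
  have hM : 0 ≤ M := (abs_nonneg _).trans ha
  have hh : 0 ≤ Q.h := mul_nonneg zero_le_two Q.maxEdge_nonneg
  have hq := Q.corner_spec hF
  set W₀ := W (Q.corner F 0)
  have hWd : ∀ x ∈ Metric.closedBall (Q.corner F 0) Q.h, ‖W x - W₀‖ ≤ 4 * M * Q.h := by
    intro x hx
    refine (norm_affineField_sub_le ha hb hd _ _).trans ?_
    rw [← dist_eq_norm]
    gcongr; exact hx
  have h1 : ‖Q.grad u F - W₀‖ ≤ 4 * K * (m + 4 * M * Q.h) := by
    refine Q.norm_grad_sub_le hF hK hD hu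
      (hS.inter (convex_closedBall (Q.corner F 0) Q.h)) (fun i => ⟨hSF i, hq.dist_le _ _⟩) ?_
    rintro x ⟨hxS, hx⟩
    calc ‖fderiv ℝ u x - innerSL ℝ W₀‖ =
        ‖(fderiv ℝ u x - innerSL ℝ (W x)) + innerSL ℝ (W x - W₀)‖ := by
          rw [map_sub]; congr 1; abel
      _ ≤ ‖fderiv ℝ u x - innerSL ℝ (W x)‖ + ‖innerSL ℝ (W x - W₀)‖ := norm_add_le _ _
      _ ≤ m + 4 * M * Q.h := by
        rw [innerSL_apply_norm]; exact add_le_add (hv x hxS) (hWd x hx)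
  -- The constant field `W₀` contributes equally to both expressions by `conormal_eq_sum`, so only
  -- deviations from `W₀` remain.
  have h2 : inner ℝ (Q.grad u F) (Q.conormal F χ) -
      ∑ i, (χ (Q.corner F i) + χ (Q.corner F (i + 1))) *
        inner ℝ (W ((Q.corner F i + Q.corner F (i + 1)) / 2))
          (-Complex.I * (Q.corner F (i + 1) - Q.corner F i)) =
      inner ℝ (Q.grad u F - W₀) (Q.conormal F χ) -
      ∑ i, (χ (Q.corner F i) + χ (Q.corner F (i + 1))) *
        inner ℝ (W ((Q.corner F i + Q.corner F (i + 1)) / 2) - W₀)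
          (-Complex.I * (Q.corner F (i + 1) - Q.corner F i)) := by
    have : inner ℝ W₀ (Q.conormal F χ) = ∑ i, (χ (Q.corner F i) + χ (Q.corner F (i + 1))) *
        inner ℝ W₀ (-Complex.I * (Q.corner F (i + 1) - Q.corner F i)) := by
      rw [conormal_eq_sum, inner_sum]
      simp_rw [inner_smul_right]
    rw [inner_sub_left, this, ← sub_add_eq_sub_sub, ← Finset.sum_add_distrib]
    congr 1
    refine Finset.sum_congr rfl fun i _ => ?_
    rw [← mul_add, ← inner_add_left, add_sub_cancel]
  rw [h2]
  refine (abs_sub _ _).trans (add_le_add ?_ ?_)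
  · refine (abs_real_inner_le_norm _ _).trans ?_
    gcongr
    exact Q.norm_conormal_le hB hF T hT
  · refine (Finset.abs_sum_le_sum_abs _ _).trans ?_
    refine (Finset.sum_le_card_nsmul _ _ (4 * M * Q.h ^ 2) fun i _ => ?_).trans
      (by simp; linarith)
    rw [abs_mul]
    refine (mul_le_of_le_one_left (abs_nonneg _) (Q.indicator_corner hB hF T hT i)).trans ?_
    refine (abs_real_inner_le_norm _ _).trans ?_
    have hmid : (Q.corner F i + Q.corner F (i + 1)) / 2 ∈ Metric.closedBall (Q.corner F 0) Q.h := by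
      have := (convex_closedBall (Q.corner F 0) Q.h).segment_subset
        (hq.dist_le i 0) (hq.dist_le (i + 1) 0) (midpoint_mem_segment (𝕜 := ℝ) _ _)
      convert this using 1
      rw [midpoint_eq_smul_add, Complex.real_smul, invOf_eq_inv]; push_cast; ring
    rw [norm_mul, norm_neg, Complex.norm_I, one_mul, ← dist_eq_norm (Q.corner F (i + 1))]
    calc _ ≤ (4 * M * Q.h) * Q.h := by
          gcongr
          · exact hWd _ hmid
          · exact hq.dist_le _ _
      _ = _ := by ring

end QuadLattice

/-! ### Squares of arbitrary direction. -/

lemma mem_closedSquare_of_dist_le {c d : ℂ} {r s : ℝ} (hd : ‖d‖ = 1) {z w : ℂ}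
    (hz : z ∈ closedSquare c d r) (hzw : dist w z ≤ s) : w ∈ closedSquare c d (r + 2 * s) := by
  have e : (w - c) * (starRingEnd ℂ) d =
      (z - c) * (starRingEnd ℂ) d + (w - z) * (starRingEnd ℂ) d := by ring
  have hn : ‖(w - z) * (starRingEnd ℂ) d‖ ≤ s := by
    rw [norm_mul, RCLike.norm_conj, hd, mul_one, ← dist_eq_norm]; exact hzw
  have h1 := (Complex.abs_re_le_norm _).trans hn
  have h2 := (Complex.abs_im_le_norm _).trans hn
  obtain ⟨h3, h4⟩ := hz
  constructor
  · rw [e, Complex.add_re]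
    exact (abs_add_le _ _).trans (by linarith)
  · rw [e, Complex.add_im]
    exact (abs_add_le _ _).trans (by linarith)

lemma isClosed_closedSquare (c d : ℂ) (r : ℝ) : IsClosed (closedSquare c d r) :=
  (isClosed_le (f := fun z : ℂ => |((z - c) * (starRingEnd ℂ) d).re|) (by fun_prop)
    continuous_const).inter
  (isClosed_le (f := fun z : ℂ => |((z - c) * (starRingEnd ℂ) d).im|) (by fun_prop)
    continuous_const)

lemma convex_closedSquare (c d : ℂ) (r : ℝ) : Convex ℝ (closedSquare c d r) := by
  have key : ∀ x y s t : ℝ, 0 ≤ s → 0 ≤ t → s + t = 1 → |x| ≤ r / 2 → |y| ≤ r / 2 →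
      |s * x + t * y| ≤ r / 2 := fun x y s t hs ht hst hx hy => by
    calc |s * x + t * y| ≤ s * |x| + t * |y| := by
          refine (abs_add_le _ _).trans ?_
          rw [abs_mul, abs_mul, abs_of_nonneg hs, abs_of_nonneg ht]
      _ ≤ s * (r / 2) + t * (r / 2) := by gcongr
      _ = r / 2 := by rw [← add_mul, hst, one_mul]
  rintro z ⟨h1, h2⟩ w ⟨h3, h4⟩ s t hs ht hst
  have e : (s • z + t • w - c) * (starRingEnd ℂ) d =
      s * ((z - c) * (starRingEnd ℂ) d) + t * ((w - c) * (starRingEnd ℂ) d) := by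
    have : (s : ℂ) + t = 1 := by exact_mod_cast hst
    simp only [Complex.real_smul]
    linear_combination (c * (starRingEnd ℂ) d) * this
  have e1 := key _ _ s t hs ht hst h1 h3
  have e2 := key _ _ s t hs ht hst h2 h4
  constructor
  · rw [e]; simpa using e1
  · rw [e]; simpa using e2

lemma volume_closedSquare {c d : ℂ} (hd : ‖d‖ = 1) {r : ℝ} (hr : 0 ≤ r) :
    volume (closedSquare c d r) = ENNReal.ofReal (r ^ 2) := by
  set u : Circle := ⟨(starRingEnd ℂ) d, by simp [Submonoid.unitSphere, hd]⟩ with hu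
  have hmp : MeasurePreserving (fun z : ℂ => (rotation u) (z - c)) :=
    (rotation u).measurePreserving.comp (measurePreserving_sub_right volume c)
  have hmp2 := Complex.volume_preserving_equiv_real_prod.comp hmp
  have hS : closedSquare c d r = (Complex.measurableEquivRealProd ∘ fun z => (rotation u) (z - c)) ⁻¹'
      (Icc (-(r / 2)) (r / 2) ×ˢ Icc (-(r / 2)) (r / 2)) := by
    ext z
    have : rotation u (z - c) = (z - c) * (starRingEnd ℂ) d := by
      rw [rotation_apply, mul_comm]
    simp only [closedSquare, mem_ofPred_eq, mem_preimage, Function.comp, this,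
      Complex.measurableEquivRealProd_apply, mem_prod, mem_Icc, abs_le]
  rw [hS, hmp2.measure_preimage (measurableSet_Icc.prod measurableSet_Icc).nullMeasurableSet,
    Measure.volume_eq_prod, Measure.prod_prod, Real.volume_Icc, ← ENNReal.ofReal_mul (by linarith)]
  congr 1; ring

lemma dist_center_le {c d : ℂ} (hd : ‖d‖ = 1) {r : ℝ} {z : ℂ} (hz : z ∈ closedSquare c d r) :
    dist z c ≤ r := by
  have h : ‖(z - c) * (starRingEnd ℂ) d‖ = ‖z - c‖ := by
    rw [norm_mul, RCLike.norm_conj, hd, mul_one]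
  rw [dist_eq_norm, ← h]
  have := Complex.norm_le_abs_re_add_abs_im ((z - c) * (starRingEnd ℂ) d)
  linarith [hz.1, hz.2]

/-! ### Consequences of the eccentricity: counting faces along the boundary of a square. -/

namespace QuadLattice

open PlaneGraph

variable (Q : QuadLattice) {F : Set ℂ}

lemma condD_mono {K K' : ℝ} (hK : 0 < K) (h : K ≤ K') (hD : Q.CondD K) : Q.CondD K' := by
  intro F hF
  obtain ⟨h1, h2, h3, h4⟩ := hD F hF
  have := one_div_le_one_div_of_le hK h
  exact ⟨h1.trans_le h, h2.trans_le h, this.trans_lt h3, this.trans_lt h4⟩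

lemma condU_pos {K : ℝ} (hU : Q.CondU K) : 0 < K := (Nat.cast_nonneg _).trans_lt (hU 0)

/-- Ensures that the infimum defining the eccentricity is over a nonempty set. The diagonals are not
parallel because the signed area is nonzero. -/
lemma exists_cond : ∃ K, Q.CondD K ∧ Q.CondU K := by
  have hU : ∀ᶠ K : ℝ in atTop, Q.CondU K := by
    filter_upwards [eventually_gt_atTop (Q.verts.card : ℝ)] with K hK c
    refine lt_of_le_of_lt ?_ hK
    norm_cast
    rw [← Set.ncard_coe_finset]
    exact ncard_le_ncard inter_subset_left Q.verts.finite_toSet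
  have hD : ∀ᶠ K : ℝ in atTop, Q.CondD K := by
    refine (eventually_all_finite Q.finite_faces).2 fun F hF => ?_
    have hinv : Tendsto (fun K : ℝ => 1 / K) atTop (𝓝 0) := by
      simpa using tendsto_inv_atTop_zero (𝕜 := ℝ)
    have hs : Real.sin (InnerProductGeometry.angle (Q.diag₁ F) (Q.diag₂ F)) ≠ 0 := by
      have := abs_pos.2 (Q.signedArea_ne_zero hF)
      rw [signedArea, abs_cross_eq] at this
      exact left_ne_zero_of_mul this.ne'
    have h0 : 0 < InnerProductGeometry.angle (Q.diag₁ F) (Q.diag₂ F) :=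
      (InnerProductGeometry.angle_nonneg _ _).lt_of_ne' fun h => hs (by rw [h, Real.sin_zero])
    have h1 : 0 < Real.pi - InnerProductGeometry.angle (Q.diag₁ F) (Q.diag₂ F) :=
      sub_pos.2 ((InnerProductGeometry.angle_le_pi _ _).lt_of_ne
        fun h => hs (by rw [h, Real.sin_pi]))
    filter_upwards [eventually_gt_atTop (‖Q.diag₁ F‖ / ‖Q.diag₂ F‖),
      eventually_gt_atTop (‖Q.diag₂ F‖ / ‖Q.diag₁ F‖), hinv.eventually_lt_const h0,
      hinv.eventually_lt_const h1] with K k1 k2 k3 k4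
    exact ⟨k1, k2, k3, k4⟩
  exact (hD.and hU).exists

/-- The infimum need not be attained, but both conditions persist when `K` grows, so they hold at
any larger value; adding 1 is enough. -/
lemma cond_eccentricity : 0 < Q.eccentricity + 1 ∧ Q.CondD (Q.eccentricity + 1) ∧
    Q.CondU (Q.eccentricity + 1) := by
  obtain ⟨K, ⟨hD, hU⟩, hK⟩ := Real.lt_sInf_add_pos
    (s := {K | Q.CondD K ∧ Q.CondU K}) Q.exists_cond one_pos
  have hK0 := Q.condU_pos hU
  exact ⟨hK0.trans hK, Q.condD_mono hK0 hK.le hD, fun c => (hU c).trans hK⟩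

/-- The vertices in a disk whose radius is the maximal edge length. -/
def vertsNear (c : ℂ) : Finset ℂ := by
  classical exact Q.verts.filter (fun v => dist v c ≤ Q.maxEdge)

lemma mem_vertsNear {c v : ℂ} : v ∈ Q.vertsNear c ↔ v ∈ Q.verts ∧ dist v c ≤ Q.maxEdge := by
  classical simp [vertsNear]

lemma card_vertsNear_le {K : ℝ} (hU : Q.CondU K) (c : ℂ) : (Q.vertsNear c).card ≤ ⌊K⌋₊ := by
  refine Nat.le_floor ((le_of_eq ?_).trans (hU c).le)
  rw [← Set.ncard_coe_finset]
  congr 2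
  ext v
  simp [mem_vertsNear]

/-- There are few vertices in a strip along the side of a square. -/
lemma card_strip_le {K : ℝ} (hU : Q.CondU K) (hρ : 0 < Q.maxEdge) {c d : ℂ} {r : ℝ}
    (hd : ‖d‖ = 1) (N : Finset ℂ) (hN : ∀ v ∈ N, v ∈ Q.verts ∧
      r / 2 - Q.maxEdge ≤ ((v - c) * (starRingEnd ℂ) d).re ∧
      ((v - c) * (starRingEnd ℂ) d).re ≤ r / 2 ∧ |((v - c) * (starRingEnd ℂ) d).im| ≤ r / 2) :
    N.card ≤ (⌊r / Q.maxEdge⌋₊ + 1) * ⌊K⌋₊ := by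
  classical
  set ρ := Q.maxEdge
  -- Centres of successive `ρ × ρ` cells covering the strip; a cell lies within `ρ/2 + ρ/2 = ρ` of
  -- its centre.
  let p : ℕ → ℂ := fun k => c + d * ⟨r / 2 - ρ / 2, -(r / 2) + (k + 1 / 2) * ρ⟩
  have hsub : N ⊆ (Finset.range (⌊r / ρ⌋₊ + 1)).biUnion fun k => Q.vertsNear (p k) := by
    intro v hv
    obtain ⟨hvQ, h1, h2, h3⟩ := hN v hv
    set x := (v - c) * (starRingEnd ℂ) d with hx
    rw [abs_le] at h3
    set y := (x.im + r / 2) / ρ with hy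
    have hy0 : 0 ≤ y := div_nonneg (by linarith) hρ.le
    have hyr : y ≤ r / ρ := by rw [hy]; gcongr; linarith
    have hxim : x.im = y * ρ - r / 2 := by rw [hy]; field_simp; ring
    have f1 := Nat.floor_le hy0
    have f2 := Nat.lt_floor_add_one y
    refine Finset.mem_biUnion.2 ⟨⌊y⌋₊, ?_, Q.mem_vertsNear.2 ⟨hvQ, ?_⟩⟩
    · rw [Finset.mem_range, Nat.lt_succ_iff]
      exact Nat.floor_le_floor hyr
    · have hdd : d * (starRingEnd ℂ) d = 1 := by
        rw [Complex.mul_conj, Complex.normSq_eq_norm_sq, hd]; simp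
      have e : (v - p ⌊y⌋₊) * (starRingEnd ℂ) d =
          x - ⟨r / 2 - ρ / 2, -(r / 2) + (⌊y⌋₊ + 1 / 2) * ρ⟩ := by
        simp only [p, hx]
        linear_combination (-(⟨r / 2 - ρ / 2, -(r / 2) + (⌊y⌋₊ + 1 / 2) * ρ⟩ : ℂ)) * hdd
      have e2 : dist v (p ⌊y⌋₊) = ‖(v - p ⌊y⌋₊) * (starRingEnd ℂ) d‖ := by
        rw [norm_mul, RCLike.norm_conj, hd, mul_one, dist_eq_norm]
      rw [e2, e]
      refine (Complex.norm_le_abs_re_add_abs_im _).trans ?_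
      have g1 : |(x - ⟨r / 2 - ρ / 2, -(r / 2) + (⌊y⌋₊ + 1 / 2) * ρ⟩ : ℂ).re| ≤ ρ / 2 := by
        rw [Complex.sub_re, abs_le]; constructor <;> simp only <;> linarith
      have g2 : |(x - ⟨r / 2 - ρ / 2, -(r / 2) + (⌊y⌋₊ + 1 / 2) * ρ⟩ : ℂ).im| ≤ ρ / 2 := by
        rw [Complex.sub_im, abs_le, hxim]
        constructor <;> simp only <;> nlinarith
      linarith
  refine (Finset.card_le_card hsub).trans ?_
  refine (Finset.card_biUnion_le_card_mul _ _ _ fun k _ => Q.card_vertsNear_le hU (p k)).trans ?_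
  rw [Finset.card_range]

/-- There are few vertices of the square near its boundary. -/
lemma card_nearBoundary_le {K : ℝ} (hU : Q.CondU K) (hρ : 0 < Q.maxEdge) {c d : ℂ} {r : ℝ}
    (hd : ‖d‖ = 1) (N : Finset ℂ) (hN : ∀ v ∈ N, v ∈ Q.verts ∧ v ∈ closedSquare c d r ∧
      ∃ w, dist v w ≤ Q.maxEdge ∧ w ∉ closedSquare c d r) :
    N.card ≤ 4 * ((⌊r / Q.maxEdge⌋₊ + 1) * ⌊K⌋₊) := by
  classical
  let P : ℂ → ℂ → Prop := fun d v => r / 2 - Q.maxEdge ≤ ((v - c) * (starRingEnd ℂ) d).re ∧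
      ((v - c) * (starRingEnd ℂ) d).re ≤ r / 2 ∧ |((v - c) * (starRingEnd ℂ) d).im| ≤ r / 2
  have hcard : ∀ d' : ℂ, ‖d'‖ = 1 →
      (N.filter (P d')).card ≤ (⌊r / Q.maxEdge⌋₊ + 1) * ⌊K⌋₊ := fun d' hd' =>
    Q.card_strip_le hU hρ hd' _ fun v hv =>
      ⟨(hN v (Finset.mem_filter.1 hv).1).1, (Finset.mem_filter.1 hv).2⟩
  -- A vertex near the boundary lies in the strip along one of the four sides, obtained by turning
  -- `d` through right angles.
  have hsub : N ⊆ (N.filter (P d) ∪ N.filter (P (-d))) ∪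
      (N.filter (P (Complex.I * d)) ∪ N.filter (P (-(Complex.I * d)))) := by
    intro v hv
    obtain ⟨-, ⟨h1, h2⟩, w, hvw, hw⟩ := hN v hv
    have hn : ‖(v - c) * (starRingEnd ℂ) d - (w - c) * (starRingEnd ℂ) d‖ ≤ Q.maxEdge := by
      rw [← sub_mul, norm_mul, RCLike.norm_conj, hd, mul_one, sub_sub_sub_cancel_right,
        ← dist_eq_norm]
      exact hvw
    have g1 := (Complex.abs_re_le_norm _).trans hn
    have g2 := (Complex.abs_im_le_norm _).trans hn
    have hw' : r / 2 < |((w - c) * (starRingEnd ℂ) d).re| ∨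
        r / 2 < |((w - c) * (starRingEnd ℂ) d).im| := by
      by_contra! h; exact hw h
    have e1 : (v - c) * (starRingEnd ℂ) (-d) = -((v - c) * (starRingEnd ℂ) d) := by simp
    have e2 : (v - c) * (starRingEnd ℂ) (Complex.I * d) =
        -Complex.I * ((v - c) * (starRingEnd ℂ) d) := by simp; ring
    have e3 : (v - c) * (starRingEnd ℂ) (-(Complex.I * d)) =
        Complex.I * ((v - c) * (starRingEnd ℂ) d) := by simp; ring
    simp only [Finset.mem_union, Finset.mem_filter, hv, true_and, P, e1, e2, e3]
    generalize (v - c) * (starRingEnd ℂ) d = x at *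
    generalize (w - c) * (starRingEnd ℂ) d = y at *
    simp only [Complex.sub_re, Complex.sub_im, abs_le, lt_abs, Complex.neg_re, Complex.neg_im,
      Complex.mul_re, Complex.mul_im, Complex.I_re, Complex.I_im] at *
    rcases hw' with (h | h) | (h | h)
    · left; left; refine ⟨?_, ?_, ?_, ?_⟩ <;> linarith
    · left; right; refine ⟨?_, ?_, ?_, ?_⟩ <;> linarith
    · right; left; refine ⟨?_, ?_, ?_, ?_⟩ <;> linarith
    · right; right; refine ⟨?_, ?_, ?_, ?_⟩ <;> linarith
  have k1 := hcard d hd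
  have k2 := hcard (-d) (by rwa [norm_neg])
  have k3 := hcard (Complex.I * d) (by simpa using hd)
  have k4 := hcard (-(Complex.I * d)) (by simpa using hd)
  have u0 := Finset.card_le_card hsub
  have u1 := Finset.card_union_le (N.filter (P d) ∪ N.filter (P (-d)))
    (N.filter (P (Complex.I * d)) ∪ N.filter (P (-(Complex.I * d))))
  have u2 := Finset.card_union_le (N.filter (P d)) (N.filter (P (-d)))
  have u3 := Finset.card_union_le (N.filter (P (Complex.I * d)))
    (N.filter (P (-(Complex.I * d))))
  linarith

/-- The number of faces with a corner in a given set of vertices. -/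
lemma card_faces_le {K : ℝ} (hU : Q.CondU K) (N : Finset ℂ) (C : Finset (Set ℂ))
    (hC : ∀ F ∈ C, F ∈ Q.faces ∧ ∃ j, Q.corner F j ∈ N) :
    C.card ≤ 4 * (N.card * (⌊K⌋₊ * ⌊K⌋₊)) := by
  classical
  have hj : ∀ j : Fin 4, (C.filter fun F => Q.corner F j ∈ N).card ≤
      N.card * (⌊K⌋₊ * ⌊K⌋₊) := by
    intro j
    -- Triples of vertices with consecutive ones at most `maxEdge` apart; a face is determined by
    -- three successive corners.
    let S : Finset (ℂ × ℂ × ℂ) := N.biUnion fun a => (Q.vertsNear a).biUnion fun b =>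
      (Q.vertsNear b).image fun e => (a, b, e)
    have hS : S.card ≤ N.card * (⌊K⌋₊ * ⌊K⌋₊) := by
      refine Finset.card_biUnion_le_card_mul _ _ _ fun a _ => ?_
      refine (Finset.card_biUnion_le_card_mul _ _ _ fun b _ =>
        Finset.card_image_le.trans (Q.card_vertsNear_le hU b)).trans ?_
      gcongr
      exact Q.card_vertsNear_le hU a
    refine le_trans (Finset.card_le_card_of_injOn
      (fun F => (Q.corner F j, Q.corner F (j + 1), Q.corner F (j + 2))) ?_ ?_) hS
    · intro F hF
      obtain ⟨hF, hFN⟩ := Finset.mem_filter.1 hF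
      have hq := Q.corner_spec (hC F hF).1
      have hadj : Q.graph.Adj (Q.corner F (j + 1)) (Q.corner F (j + 2)) := by
        have := hq.adj (j + 1)
        rwa [add_assoc] at this
      refine Finset.mem_biUnion.2 ⟨_, hFN, Finset.mem_biUnion.2 ⟨Q.corner F (j + 1),
        Q.mem_vertsNear.2 ⟨hq.vert_mem _, ?_⟩, Finset.mem_image.2 ⟨Q.corner F (j + 2),
        Q.mem_vertsNear.2 ⟨hq.vert_mem _, ?_⟩, rfl⟩⟩⟩
      · rw [dist_comm]; exact Q.dist_le_maxEdge (hq.adj j)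
      · rw [dist_comm]; exact Q.dist_le_maxEdge hadj
    · intro F hF G hG e
      simp only [Prod.mk.injEq] at e
      exact Q.face_eq_of_corner_eq (hC F (Finset.mem_filter.1 hF).1).1
        (hC G (Finset.mem_filter.1 hG).1).1 j e.1 e.2.1 e.2.2
  have hsub : C ⊆ Finset.univ.biUnion fun j : Fin 4 => C.filter fun F => Q.corner F j ∈ N := by
    intro F hF
    obtain ⟨j, hj⟩ := (hC F hF).2
    exact Finset.mem_biUnion.2 ⟨j, Finset.mem_univ _, Finset.mem_filter.2 ⟨hF, hj⟩⟩
  refine (Finset.card_le_card hsub).trans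
    ((Finset.card_biUnion_le_card_mul _ _ _ fun j _ => hj j).trans ?_)
  simp

/-- The number of faces crossing the boundary of a square. -/
lemma card_crossing_le {K : ℝ} (hU : Q.CondU K) {c d : ℂ} {r : ℝ} (hd : ‖d‖ = 1) (hr : Q.h < r)
    (C : Finset (Set ℂ)) (hC : ∀ F ∈ C, F ∈ Q.faces ∧ (∃ i, Q.corner F i ∈ closedSquare c d r) ∧
      ∃ j, Q.corner F j ∉ closedSquare c d r) :
    (C.card : ℝ) * Q.h ≤ 64 * K ^ 3 * r := by
  classical
  have hK := Q.condU_pos hU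
  rcases C.eq_empty_or_nonempty with rfl | ⟨F₀, hF₀⟩
  · have := Q.maxEdge_nonneg
    have : 0 ≤ r := le_trans (by rw [PlaneGraph.h]; linarith) hr.le
    simp; positivity
  have hρ : 0 < Q.maxEdge := Q.maxEdge_pos ((Q.corner_spec (hC F₀ hF₀).1).adj 0)
  let N : Finset ℂ := Q.verts.filter fun v => v ∈ closedSquare c d r ∧
      ∃ w, dist v w ≤ Q.maxEdge ∧ w ∉ closedSquare c d r
  have h1 := Q.card_nearBoundary_le hU hρ hd N fun v hv => by
    simpa [N] using hv
  have h2 := Q.card_faces_le hU N C (by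
    intro F hF
    obtain ⟨hF, ⟨i, hi⟩, j, hj⟩ := hC F hF
    refine ⟨hF, ?_⟩
    have hq := Q.corner_spec hF
    have hmem : ∀ k l, Q.corner F k ∈ closedSquare c d r → Q.corner F l ∉ closedSquare c d r →
        dist (Q.corner F k) (Q.corner F l) ≤ Q.maxEdge → Q.corner F k ∈ N := fun k l hk hl hkl =>
      Finset.mem_filter.2 ⟨hq.vert_mem k, hk, _, hkl, hl⟩
    by_contra! hn
    -- If no corner were in `N`, membership in the square would pass from each corner to the next
    -- and reach `j`.
    have step : ∀ k, Q.corner F k ∈ closedSquare c d r → Q.corner F (k + 1) ∈ closedSquare c d r :=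
      fun k hk => by_contra fun hk1 => hn k (hmem k _ hk hk1 (Q.dist_le_maxEdge (hq.adj k)))
    have hij : j = i ∨ j = i + 1 ∨ j = i + 1 + 1 ∨ j = i + 1 + 1 + 1 := by
      clear * -; revert i j; decide
    rcases hij with rfl | rfl | rfl | rfl
    · exact hj hi
    · exact hj (step _ hi)
    · exact hj (step _ (step _ hi))
    · exact hj (step _ (step _ (step _ hi))))
  have h3 : C.card ≤ 16 * (⌊r / Q.maxEdge⌋₊ + 1) * ⌊K⌋₊ ^ 3 := by
    calc C.card ≤ _ := h2
      _ ≤ 4 * (4 * ((⌊r / Q.maxEdge⌋₊ + 1) * ⌊K⌋₊) * (⌊K⌋₊ * ⌊K⌋₊)) := by gcongr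
      _ = _ := by ring
  have h4 : (C.card : ℝ) ≤ 16 * (⌊r / Q.maxEdge⌋₊ + 1) * (⌊K⌋₊ : ℝ) ^ 3 := by exact_mod_cast h3
  have h5 : (⌊K⌋₊ : ℝ) ≤ K := Nat.floor_le hK.le
  have hr' : 2 * Q.maxEdge < r := hr
  have h6 : (⌊r / Q.maxEdge⌋₊ : ℝ) ≤ r / Q.maxEdge := Nat.floor_le (div_nonneg (by linarith) hρ.le)
  -- This is where `h < r` enters: it absorbs the `+ 1` in the number of disks.
  have h7 : (1 : ℝ) ≤ r / Q.maxEdge := (one_le_div hρ).2 (by linarith)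
  have h8 : (C.card : ℝ) ≤ 16 * (2 * (r / Q.maxEdge)) * K ^ 3 := by
    refine h4.trans ?_
    gcongr
    linarith
  calc (C.card : ℝ) * Q.h ≤ 16 * (2 * (r / Q.maxEdge)) * K ^ 3 * Q.h := by
        gcongr; exact mul_nonneg zero_le_two hρ.le
    _ = 64 * K ^ 3 * r := by rw [PlaneGraph.h]; field_simp; ring

end QuadLattice

/-! ### The laplacian summed over a square, for a function with nearly affine differential. -/

namespace QuadLattice

open PlaneGraph

variable (Q : QuadLattice) {F : Set ℂ} {B : Finset ℂ}

lemma h_nonneg : 0 ≤ Q.h := mul_nonneg zero_le_two Q.maxEdge_nonneg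

lemma face_subset_closedBall (hF : F ∈ Q.faces) (i : Fin 4) :
    F ⊆ Metric.closedBall (Q.corner F i) Q.h := by
  have hq := Q.corner_spec hF
  exact (Q.isOriented hF).subset _ (convex_closedBall _ _) (hq.dist_le _ _) (hq.dist_le _ _)
    (hq.dist_le _ _) (hq.dist_le _ _)

lemma exists_corner_mem (hB : Q.IsColorClass B) (hF : F ∈ Q.faces) : ∃ i, Q.corner F i ∈ B := by
  rcases hB.2 F hF with ⟨h, -⟩ | ⟨h, -⟩
  exacts [⟨_, h⟩, ⟨_, h⟩]

/-- The faces all of whose vertices of the given color lie in a square almost tile it. -/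
lemma abs_area_sub_le (hB : Q.IsColorClass B) {c d : ℂ} {r : ℝ} (hd : ‖d‖ = 1) (hr : Q.h < r)
    (hin : closedSquare c d r ⊆ Q.inside) (I : Finset (Set ℂ))
    (hI : ∀ F, F ∈ I ↔ F ∈ Q.faces ∧ ∀ i, Q.corner F i ∈ B → Q.corner F i ∈ closedSquare c d r) :
    |∑ F ∈ I, (volume F).toReal - r ^ 2| ≤ 8 * Q.h * r := by
  have hh := Q.h_nonneg
  have hvol : volume (⋃ F ∈ I, F) = ∑ F ∈ I, volume F := by
    refine measure_biUnion_finset ?_ fun F hF => (isOpen_face ((hI F).1 hF).1).measurableSet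
    intro F hF G hG hne
    rw [Function.onFun, Set.disjoint_iff_inter_eq_empty]
    by_contra hn
    exact hne (face_eq ((hI F).1 hF).1 ((hI G).1 hG).1 (nonempty_iff_ne_empty.2 hn))
  have hup : ⋃ F ∈ I, F ⊆ closedSquare c d (r + 2 * Q.h) := by
    refine iUnion₂_subset fun F hF p hp => ?_
    obtain ⟨hF, hFI⟩ := (hI F).1 hF
    obtain ⟨i, hi⟩ := Q.exists_corner_mem hB hF
    exact mem_closedSquare_of_dist_le hd (hFI i hi) (Q.face_subset_closedBall hF i hp)
  have hfin : ∀ F ∈ I, volume F ≠ ⊤ := fun F hF => ((hI F).1 hF).1.1.measure_lt_top.ne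
  have hsum : ∑ F ∈ I, (volume F).toReal = (volume (⋃ F ∈ I, F)).toReal := by
    rw [hvol, ENNReal.toReal_sum hfin]
  have h1 : ∑ F ∈ I, (volume F).toReal ≤ (r + 2 * Q.h) ^ 2 := by
    rw [hsum]
    refine ENNReal.toReal_le_of_le_ofReal (by positivity) ?_
    rw [← volume_closedSquare (c := c) hd (by linarith)]
    exact measure_mono hup
  have h2 : r ^ 2 - 4 * Q.h * r ≤ ∑ F ∈ I, (volume F).toReal := by
    -- For `r < 2h` there is no inner square, but then `r² - 4hr` is negative and the lower bound is
    -- trivial.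
    rcases lt_or_ge r (2 * Q.h) with hlt | hge
    · have : 0 ≤ ∑ F ∈ I, (volume F).toReal := Finset.sum_nonneg fun _ _ => ENNReal.toReal_nonneg
      nlinarith
    -- A point of the shrunken square off the graph lies in a face whose corners are within `h` of
    -- it, hence in the original square; the graph itself is null.
    · have hlow : closedSquare c d (r - 2 * Q.h) ⊆ (⋃ F ∈ I, F) ∪ Q.support := by
        intro p hp
        by_cases hpQ : p ∈ Q.support
        · exact Or.inr hpQ
        have hpR : p ∈ closedSquare c d r :=
          ⟨hp.1.trans (by linarith), hp.2.trans (by linarith)⟩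
        obtain ⟨F, hF, hpF⟩ := exists_face (Q := Q.toPlaneGraph) isPreconnected_singleton
          (Set.disjoint_singleton_left.2 hpQ) (mem_singleton p)
          ⟨p, hin hpR, subset_closure (mem_singleton p)⟩
        refine Or.inl (mem_iUnion₂.2 ⟨F, (hI F).2 ⟨hF, fun i _ => ?_⟩, hpF rfl⟩)
        have := Q.face_subset_closedBall hF i (hpF rfl)
        have := mem_closedSquare_of_dist_le hd hp (w := Q.corner F i) (s := Q.h)
          (by rw [dist_comm]; exact this)
        rwa [sub_add_cancel] at this
      have h3 : ENNReal.ofReal ((r - 2 * Q.h) ^ 2) ≤ volume (⋃ F ∈ I, F) := by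
        rw [← volume_closedSquare (c := c) hd (by linarith)]
        refine (measure_mono hlow).trans ((measure_union_le _ _).trans ?_)
        rw [Q.volume_support, add_zero]
      have h4 : (r - 2 * Q.h) ^ 2 ≤ (volume (⋃ F ∈ I, F)).toReal := by
        refine (ENNReal.ofReal_le_iff_le_toReal ?_).1 h3
        rw [hvol]
        exact (ENNReal.sum_lt_top.2 fun F hF => (hfin F hF).lt_top).ne
      rw [hsum]
      nlinarith
  rw [abs_le]
  constructor <;> nlinarith

/-- The sum of the discrete laplacian over a square, for a function whose differential is
close to an affine field. -/
lemma abs_sum_laplacian_sub_le (hB : Q.IsColorClass B) {c d : ℂ} {r : ℝ} (hd : ‖d‖ = 1)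
    (hr : Q.h < r) (hin : closedSquare c d r ⊆ Q.inside) {K m M : ℝ} (hD : Q.CondD K)
    (hU : Q.CondU K) (hm : 0 ≤ m) {l : ℂ} {a₁ a₂ a₃ : ℝ} (h₁ : |a₁| ≤ M) (h₂ : |a₂| ≤ M)
    (h₃ : |a₃| ≤ M) {u : ℂ → ℝ} (hu : Differentiable ℝ u)
    (hv : ∀ x ∈ Metric.cthickening Q.h (closedSquare c d r),
      ‖fderiv ℝ u x - innerSL ℝ (affineField l a₁ a₂ a₃ c x)‖ ≤ m) :
    |∑ᶠ z ∈ closedSquare c d r ∩ (B : Set ℂ), Q.laplacian u z - (a₁ + a₃) * r ^ 2| ≤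
      64 * K ^ 3 * r * (4 * K * (m + 4 * M * Q.h) + 16 * M * Q.h) + 16 * M * Q.h * r := by
  classical
  have hh := Q.h_nonneg
  have hK := Q.condU_pos hU
  have hM : 0 ≤ M := (abs_nonneg _).trans h₁
  set T : Finset ℂ := B.filter (fun z => z ∈ closedSquare c d r) with hT
  have hTB : T ⊆ B := Finset.filter_subset _ _
  have hTc : closedSquare c d r ∩ (B : Set ℂ) = (T : Set ℂ) := by
    ext z; simp [hT, and_comm]
  set χ : ℂ → ℝ := (T : Set ℂ).indicator 1 with hχ
  have χ1 : ∀ z ∈ T, χ z = 1 := fun z hz => indicator_of_mem (Finset.mem_coe.2 hz) _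
  have χ0 : ∀ z, z ∉ T → χ z = 0 := fun z hz => indicator_of_notMem (fun h => hz h) _
  set W := affineField l a₁ a₂ a₃ c
  -- The weight is antisymmetric, and nonzero only if an end is in `T`, hence inside `∂Q`; so its
  -- total over all oriented face boundaries vanishes.
  let w : ℂ → ℂ → ℝ := fun x y => (χ x + χ y) * inner ℝ (W ((x + y) / 2)) (-Complex.I * (y - x))
  have hflux := Q.sum_side_eq_zero w
    (fun x y => by
      simp only [w]
      rw [add_comm y x, add_comm (χ y), ← mul_neg, ← inner_neg_right]
      congr 2; ring)
    (fun x y hxy => by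
      have : χ x ≠ 0 ∨ χ y ≠ 0 := by
        by_contra! h
        exact hxy (by simp only [w]; rw [h.1, h.2]; simp)
      refine this.imp ?_ ?_ <;> intro hz <;>
        exact hin (Finset.mem_filter.1 (not_imp_comm.1 (χ0 _) hz)).2)
  let E : Set ℂ → ℝ := fun F => inner ℝ (Q.grad u F) (Q.conormal F χ) -
    ∑ i, w (Q.corner F i) (Q.corner F (i + 1))
  have hS : ∑ᶠ z ∈ closedSquare c d r ∩ (B : Set ℂ), Q.laplacian u z =
      -∑ F ∈ Q.faceFinset, Q.sgn F * E F := by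
    rw [hTc, finsum_mem_coe_finset, Q.sum_laplacian]
    simp only [E, mul_sub, Finset.sum_sub_distrib]
    rw [hflux, sub_zero]
  let I := Q.faceFinset.filter fun F => ∀ i, Q.corner F i ∈ B → Q.corner F i ∈ closedSquare c d r
  let C := (Q.faceFinset.filter fun F => ¬ ∀ i, Q.corner F i ∈ B →
    Q.corner F i ∈ closedSquare c d r).filter fun F => ∃ i, Q.corner F i ∈ T
  have hIE : ∀ F ∈ I, Q.sgn F * E F = -((a₁ + a₃) * (volume F).toReal) := by
    intro F hF
    obtain ⟨hF, hFI⟩ := Finset.mem_filter.1 hF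
    rw [mem_faceFinset] at hF
    have hT1 : ∀ i, Q.corner F i ∈ B → χ (Q.corner F i) = 1 := fun i hi =>
      χ1 _ (Finset.mem_filter.2 ⟨hi, hFI i hi⟩)
    have hT0 : ∀ i, Q.corner F i ∉ B → χ (Q.corner F i) = 0 := fun i hi =>
      χ0 _ (fun h => hi (hTB h))
    -- Here `χ` is the indicator of the color class on the corners: constant along each diagonal,
    -- with values 1 and 0 at the ends of each side.
    have hc : Q.conormal F χ = 0 ∧ ∀ i, χ (Q.corner F i) + χ (Q.corner F (i + 1)) = 1 := by
      rw [conormal_apply]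
      rcases hB.2 F hF with ⟨b0, b2, b1, b3⟩ | ⟨b1, b3, b0, b2⟩
      · rw [hT1 _ b0, hT1 _ b2, hT0 _ b1, hT0 _ b3]
        refine ⟨by simp, fun i => ?_⟩
        fin_cases i <;> simp [hT1 _ b0, hT1 _ b2, hT0 _ b1, hT0 _ b3]
      · rw [hT1 _ b1, hT1 _ b3, hT0 _ b0, hT0 _ b2]
        refine ⟨by simp, fun i => ?_⟩
        fin_cases i <;> simp [hT1 _ b1, hT1 _ b3, hT0 _ b0, hT0 _ b2]
    have hw : ∑ i, w (Q.corner F i) (Q.corner F (i + 1)) = (a₁ + a₃) * Q.signedArea F / 2 := by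
      rw [← Q.sum_flux F l a₁ a₂ a₃ c]
      refine Finset.sum_congr rfl fun i _ => ?_
      simp only [w]
      rw [hc.2, one_mul]
    simp only [E]
    rw [hc.1, inner_zero_right, hw, Q.volume_face hF]
    ring
  have hOE : ∀ F ∈ Q.faceFinset, (∀ i, Q.corner F i ∉ T) → E F = 0 := by
    intro F _ hFT
    have h0 : ∀ i, χ (Q.corner F i) = 0 := fun i => χ0 _ (hFT i)
    simp [E, w, conormal_apply, h0]
  have hCm : ∀ F ∈ C, F ∈ Q.faces ∧ (∃ i, Q.corner F i ∈ closedSquare c d r) ∧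
      ∃ j, Q.corner F j ∉ closedSquare c d r := by
    intro F hF
    obtain ⟨hF, i, hi⟩ := Finset.mem_filter.1 hF
    obtain ⟨hF, hj⟩ := Finset.mem_filter.1 hF
    push Not at hj
    obtain ⟨j, -, hj⟩ := hj
    exact ⟨Q.mem_faceFinset.1 hF, ⟨i, (Finset.mem_filter.1 hi).2⟩, j, hj⟩
  have hCE : ∀ F ∈ C, |Q.sgn F * E F| ≤ 4 * K * (m + 4 * M * Q.h) * Q.h + 16 * M * Q.h ^ 2 := by
    intro F hF
    obtain ⟨hF, ⟨i, hi⟩, -⟩ := hCm F hF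
    have hs : |Q.sgn F| = 1 := by
      rcases (Q.isOriented hF).sign with h | h <;> simp [h]
    rw [abs_mul, hs, one_mul]
    exact Q.face_error hB hF T hTB hK hm h₁ h₂ h₃ hD hu ((convex_closedSquare c d r).cthickening _)
      (fun j => Metric.mem_cthickening_of_dist_le _ _ _ _ hi ((Q.corner_spec hF).dist_le j i)) hv
  -- Faces outside `I` with no corner in `T` have `E F = 0`, so only the crossing faces `C` remain
  -- besides `I`.
  have hsplit : ∑ F ∈ Q.faceFinset, Q.sgn F * E F =
      ∑ F ∈ I, Q.sgn F * E F + ∑ F ∈ C, Q.sgn F * E F := by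
    rw [← Finset.sum_filter_add_sum_filter_not Q.faceFinset
      (fun F => ∀ i, Q.corner F i ∈ B → Q.corner F i ∈ closedSquare c d r)]
    congr 1
    refine (Finset.sum_subset (Finset.filter_subset _ _) fun F hF hFC => ?_).symm
    rw [hOE F (Finset.mem_filter.1 hF).1, mul_zero]
    intro i hi
    exact hFC (Finset.mem_filter.2 ⟨hF, i, hi⟩)
  have hsumC : |∑ F ∈ C, Q.sgn F * E F| ≤
      64 * K ^ 3 * r * (4 * K * (m + 4 * M * Q.h) + 16 * M * Q.h) := by
    refine (Finset.abs_sum_le_sum_abs _ _).trans ((Finset.sum_le_card_nsmul _ _ _ hCE).trans ?_)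
    rw [nsmul_eq_mul]
    calc _ = (C.card : ℝ) * Q.h * (4 * K * (m + 4 * M * Q.h) + 16 * M * Q.h) := by ring
      _ ≤ _ := by
        refine mul_le_mul_of_nonneg_right (Q.card_crossing_le hU hd hr C hCm) ?_
        positivity
  have harea := Q.abs_area_sub_le hB hd hr hin I fun F => by
    simp only [I, Finset.mem_filter, mem_faceFinset]
  have e : ∑ᶠ z ∈ closedSquare c d r ∩ (B : Set ℂ), Q.laplacian u z - (a₁ + a₃) * r ^ 2 =
      -(∑ F ∈ C, Q.sgn F * E F) + (a₁ + a₃) * (∑ F ∈ I, (volume F).toReal - r ^ 2) := by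
    rw [hS, hsplit, Finset.sum_congr rfl hIE, Finset.sum_neg_distrib, ← Finset.mul_sum]
    ring
  rw [e]
  refine (abs_add_le _ _).trans (add_le_add (by rwa [abs_neg]) ?_)
  rw [abs_mul]
  calc |a₁ + a₃| * |∑ F ∈ I, (volume F).toReal - r ^ 2| ≤ (2 * M) * (8 * Q.h * r) := by
        gcongr
        exact (abs_add_le _ _).trans (by linarith)
    _ = _ := by ring

end QuadLattice

/-! ### Derivatives of the smooth function and its Taylor field. -/

lemma minSmoothness_two_le : minSmoothness ℝ 2 ≤ ∞ := by
  rw [minSmoothness_of_isRCLikeNormedField]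
  exact WithTop.coe_le_coe.2 (le_top (a := (2 : ℕ∞)))

section Derivatives

variable {g : ℂ → ℝ}

lemma absD_apply_le (k : ℕ) (g : ℂ → ℝ) (z : ℂ) (j : Fin (k + 1)) :
    |iteratedFDeriv ℝ k g z (fun i : Fin k => if (i : ℕ) < (j : ℕ) then 1 else Complex.I)| ≤
      absD k g z :=
  le_ciSup (f := fun j : Fin (k + 1) =>
    |iteratedFDeriv ℝ k g z (fun i : Fin k => if (i : ℕ) < (j : ℕ) then 1 else Complex.I)|)
    (Set.finite_range _).bddAbove j

lemma absD_nonneg (k : ℕ) (g : ℂ → ℝ) (z : ℂ) : 0 ≤ absD k g z :=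
  Real.iSup_nonneg fun _ => abs_nonneg _

lemma absD_le_norm (k : ℕ) (g : ℂ → ℝ) (z : ℂ) : absD k g z ≤ ‖iteratedFDeriv ℝ k g z‖ := by
  refine ciSup_le fun j => ?_
  refine ((iteratedFDeriv ℝ k g z).le_opNorm _).trans ?_
  rw [Finset.prod_eq_one, mul_one]
  intro i _
  split_ifs <;> simp

/-- A real `sSup` is meaningful only for a bounded set; here `absD` is dominated by the norm of the
iterated derivative, which is continuous on the compact set. -/
lemma absD_le_sSup (hg : ContDiff ℝ ∞ g) (k : ℕ) {S : Set ℂ} (hS : IsCompact S) {z : ℂ}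
    (hz : z ∈ S) : absD k g z ≤ sSup (absD k g '' S) := by
  refine le_csSup ?_ (mem_image_of_mem _ hz)
  have hc : Continuous fun z => ‖iteratedFDeriv ℝ k g z‖ :=
    (hg.continuous_iteratedFDeriv (by exact_mod_cast le_top)).norm
  obtain ⟨M, hM⟩ := (hS.image hc).bddAbove
  refine ⟨M, ?_⟩
  rintro _ ⟨x, hx, rfl⟩
  exact (absD_le_norm k g x).trans (hM (mem_image_of_mem _ hx))

/-- The second differential. -/
def hess (g : ℂ → ℝ) : ℂ → ℂ →L[ℝ] ℂ →L[ℝ] ℝ := fderiv ℝ (fderiv ℝ g)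

lemma contDiff_fderiv (hg : ContDiff ℝ ∞ g) : ContDiff ℝ ∞ (fderiv ℝ g) :=
  hg.fderiv_right (by simp)

lemma contDiff_hess (hg : ContDiff ℝ ∞ g) : ContDiff ℝ ∞ (hess g) :=
  (contDiff_fderiv hg).fderiv_right (by simp)

lemma hess_symm (hg : ContDiff ℝ ∞ g) (z u v : ℂ) : hess g z u v = hess g z v u :=
  (hg.contDiffAt.isSymmSndFDerivAt minSmoothness_two_le).eq u v

lemma third_swap_left (hg : ContDiff ℝ ∞ g) (z u v w : ℂ) :
    fderiv ℝ (hess g) z u v w = fderiv ℝ (hess g) z v u w := by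
  have := ((contDiff_fderiv hg).contDiffAt (x := z)).isSymmSndFDerivAt minSmoothness_two_le
  exact congrArg (fun L => L w) (this.eq u v)

/-- Both sides are derivatives of the same function of `x`, by the symmetry of the second
differential at every point. -/
lemma third_swap_right (hg : ContDiff ℝ ∞ g) (z u v w : ℂ) :
    fderiv ℝ (hess g) z u v w = fderiv ℝ (hess g) z u w v := by
  have hd := ((contDiff_hess hg).differentiable (by simp) z).hasFDerivAt
  have key : ∀ a b : ℂ, HasFDerivAt (fun x => hess g x a b)
      (((fderiv ℝ (hess g) z).flip a).flip b) z := fun a b => by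
    have := (hd.clm_apply (hasFDerivAt_const a z)).clm_apply (hasFDerivAt_const b z)
    refine this.congr_fderiv ?_
    ext x; simp
  have h1 := key v w
  have h2 := key w v
  simp_rw [fun x => hess_symm hg x w v] at h2
  exact congrArg (fun L => L u) (h1.unique h2)

lemma iteratedFDeriv_three_apply (g : ℂ → ℝ) (z : ℂ) (m : Fin 3 → ℂ) :
    iteratedFDeriv ℝ 3 g z m = fderiv ℝ (hess g) z (m 0) (m 1) (m 2) := by
  rw [iteratedFDeriv_succ_apply_right, iteratedFDeriv_two_apply]
  rfl

lemma norm_le_of_basis {E : Type*} [NormedAddCommGroup E] [NormedSpace ℝ E] (L : ℂ →L[ℝ] E)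
    {A : ℝ} (h1 : ‖L 1‖ ≤ A) (hI : ‖L Complex.I‖ ≤ A) : ‖L‖ ≤ 2 * A := by
  have hA : 0 ≤ A := (norm_nonneg _).trans h1
  refine L.opNorm_le_bound (by positivity) fun z => ?_
  have e : L z = z.re • L 1 + z.im • L Complex.I := by
    rw [← map_smul, ← map_smul, ← map_add]
    congr 1
    simp [Complex.re_add_im]
  rw [e]
  refine (norm_add_le _ _).trans ?_
  rw [norm_smul, norm_smul, Real.norm_eq_abs, Real.norm_eq_abs]
  calc _ ≤ ‖z‖ * A + ‖z‖ * A := by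
        gcongr
        · exact Complex.abs_re_le_norm z
        · exact Complex.abs_im_le_norm z
    _ = _ := by ring

-- Symmetry reduces the eight entries on the basis `1, i` to the four measured by `absD 3`; each of
-- the three arguments costs a factor 2.
set_option maxSynthPendingDepth 5 in
lemma norm_third_le (hg : ContDiff ℝ ∞ g) (z : ℂ) :
    ‖fderiv ℝ (hess g) z‖ ≤ 8 * absD 3 g z := by
  set A := absD 3 g z
  set t := fderiv ℝ (hess g) z with ht
  have b0 := absD_apply_le 3 g z 0
  have b1 := absD_apply_le 3 g z 1
  have b2 := absD_apply_le 3 g z 2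
  have b3 := absD_apply_le 3 g z 3
  rw [iteratedFDeriv_three_apply, ← ht] at b0 b1 b2 b3
  norm_num at b0 b1 b2 b3
  have s1 := third_swap_left hg z
  have s2 := third_swap_right hg z
  rw [← ht] at s1 s2
  have c1 : |t 1 Complex.I 1| ≤ A := by rwa [s2]
  have c2 : |t Complex.I 1 1| ≤ A := by rwa [s1]
  have c3 : |t Complex.I 1 Complex.I| ≤ A := by rwa [s1]
  have c4 : |t Complex.I Complex.I 1| ≤ A := by rwa [s2]
  have := norm_le_of_basis t (A := 4 * A)
    ((norm_le_of_basis (t 1) (norm_le_of_basis (t 1 1) b3 b2) (norm_le_of_basis (t 1 _) c1 b1)).trans (by linarith))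
    ((norm_le_of_basis (t _) (norm_le_of_basis (t _ 1) c2 c3)
      (norm_le_of_basis (t _ _) c4 b0)).trans (by linarith))
  linarith

lemma hess_entries_le (g : ℂ → ℝ) (z : ℂ) : |hess g z 1 1| ≤ absD 2 g z ∧
    |hess g z 1 Complex.I| ≤ absD 2 g z ∧ |hess g z Complex.I Complex.I| ≤ absD 2 g z := by
  have b0 := absD_apply_le 2 g z 0
  have b1 := absD_apply_le 2 g z 1
  have b2 := absD_apply_le 2 g z 2
  rw [iteratedFDeriv_two_apply] at b0 b1 b2
  norm_num at b0 b1 b2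
  exact ⟨b2, b1, b0⟩

lemma laplacian_eq_hess (g : ℂ → ℝ) (z : ℂ) :
    Laplacian.laplacian g z = hess g z 1 1 + hess g z Complex.I Complex.I := by
  rw [InnerProductSpace.laplacian_eq_iteratedFDeriv_complexPlane]
  simp only [iteratedFDeriv_two_apply]
  rfl

/-- The gradient field of the second Taylor polynomial of `g` at `c`. -/
def taylorField (g : ℂ → ℝ) (c : ℂ) : ℂ → ℂ :=
  affineField ⟨fderiv ℝ g c 1, fderiv ℝ g c Complex.I⟩ (hess g c 1 1) (hess g c 1 Complex.I)
    (hess g c Complex.I Complex.I) c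

lemma innerSL_taylorField (hg : ContDiff ℝ ∞ g) (c x : ℂ) :
    innerSL ℝ (taylorField g c x) = fderiv ℝ g c + hess g c (x - c) := by
  ext v
  have key : ∀ (E : Type) [NormedAddCommGroup E] [NormedSpace ℝ E] (L : ℂ →L[ℝ] E) (z : ℂ),
      L z = z.re • L 1 + z.im • L Complex.I := by
    intro E _ _ L z
    rw [← map_smul, ← map_smul, ← map_add]
    congr 1
    simp [Complex.re_add_im]
  rw [innerSL_apply_apply, real_inner_eq, add_apply, key _ (fderiv ℝ g c) v,
    key _ (hess g c (x - c)) v, key _ (hess g c) (x - c)]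
  simp only [taylorField, affineField, add_apply,
    smul_apply, smul_eq_mul]
  rw [hess_symm hg c Complex.I 1]
  ring

set_option maxSynthPendingDepth 5 in
lemma norm_hess_sub_le (hg : ContDiff ℝ ∞ g) {S : Set ℂ} (hS : Convex ℝ S) {M : ℝ}
    (hM : ∀ x ∈ S, absD 3 g x ≤ M) {c x : ℂ} (hc : c ∈ S) (hx : x ∈ S) :
    ‖hess g x - hess g c‖ ≤ 8 * M * dist x c := by
  rw [dist_eq_norm]
  refine hS.norm_image_sub_le_of_norm_fderiv_le (𝕜 := ℝ) (C := 8 * M)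
    (fun y _ => (contDiff_hess hg).differentiable (by simp) y) (fun y hy => ?_) hc hx
  exact (norm_third_le hg y).trans (by linarith [hM y hy])

/-- Mean value inequality for `fderiv ℝ g - hess g c`, whose derivative `hess g y - hess g c` is
itself of size at most `8MD`. -/
lemma norm_fderiv_sub_taylorField_le (hg : ContDiff ℝ ∞ g) {S : Set ℂ} (hS : Convex ℝ S) {M D : ℝ}
    (hM : ∀ x ∈ S, absD 3 g x ≤ M) {c x : ℂ} (hc : c ∈ S) (hx : x ∈ S)
    (hD : ∀ x ∈ S, dist x c ≤ D) :
    ‖fderiv ℝ g x - innerSL ℝ (taylorField g c x)‖ ≤ 8 * M * D ^ 2 := by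
  have hM0 : 0 ≤ M := (absD_nonneg 3 g c).trans (hM c hc)
  have hD0 : 0 ≤ D := dist_nonneg.trans (hD x hx)
  rw [innerSL_taylorField hg]
  have hder : ∀ y, HasFDerivAt (fun y => fderiv ℝ g y - hess g c y) (hess g y - hess g c) y :=
    fun y => ((contDiff_fderiv hg).differentiable (by simp) y).hasFDerivAt.sub
      (hess g c).hasFDerivAt
  have := hS.norm_image_sub_le_of_norm_hasFDerivWithin_le (𝕜 := ℝ) (C := 8 * M * D)
    (fun y _ => (hder y).hasFDerivWithinAt)
    (fun y hy => (norm_hess_sub_le hg hS hM hc hy).trans (by gcongr; exact hD y hy)) hc hx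
  calc ‖fderiv ℝ g x - (fderiv ℝ g c + hess g c (x - c))‖
      = ‖fderiv ℝ g x - hess g c x - (fderiv ℝ g c - hess g c c)‖ := by
        rw [map_sub]; congr 1; abel
    _ ≤ 8 * M * D * ‖x - c‖ := this
    _ ≤ 8 * M * D * D := by
        gcongr
        rw [← dist_eq_norm]; exact hD x hx
    _ = _ := by ring

/-- The integral of the laplacian over a square is close to its value at the center times the
area. -/
lemma abs_integral_laplacian_sub_le (hg : ContDiff ℝ ∞ g) {c d : ℂ} {r : ℝ} (hd : ‖d‖ = 1)
    (hr : 0 ≤ r) {M : ℝ} (hM : ∀ x ∈ closedSquare c d r, absD 3 g x ≤ M) :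
    |(hess g c 1 1 + hess g c Complex.I Complex.I) * r ^ 2 -
      ∫ z in closedSquare c d r, Laplacian.laplacian g z| ≤ 16 * M * r ^ 3 := by
  have hc : c ∈ closedSquare c d r := by simp [closedSquare]; linarith
  have hcomp : IsCompact (closedSquare c d r) :=
    Metric.isCompact_of_isClosed_isBounded (isClosed_closedSquare c d r)
      ((Metric.isBounded_closedBall (x := c) (r := r)).subset fun z hz => dist_center_le hd hz)
  have hvol : volume (closedSquare c d r) = ENNReal.ofReal (r ^ 2) := volume_closedSquare hd hr
  have hcont : Continuous (Laplacian.laplacian g) := by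
    have h := (contDiff_hess hg).continuous
    rw [funext (laplacian_eq_hess g)]
    fun_prop
  have hint : ∫ z in closedSquare c d r, (Laplacian.laplacian g c - Laplacian.laplacian g z) =
      (hess g c 1 1 + hess g c Complex.I Complex.I) * r ^ 2 -
        ∫ z in closedSquare c d r, Laplacian.laplacian g z := by
    rw [integral_sub (continuousOn_const.integrableOn_compact hcomp)
      (hcont.continuousOn.integrableOn_compact hcomp), setIntegral_const, Measure.real, hvol,
      ENNReal.toReal_ofReal (by positivity), laplacian_eq_hess, smul_eq_mul, mul_comm]
  rw [← hint, ← Real.norm_eq_abs]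
  -- The constant is `8Mr` for each of the two diagonal entries of the second differential.
  refine (norm_setIntegral_le_of_norm_le_const (C := 16 * M * r) hcomp.measure_lt_top
    fun z hz => ?_).trans ?_
  · have h := norm_hess_sub_le hg (convex_closedSquare c d r) hM hc hz
    have h1 : ∀ e : ℂ, ‖e‖ = 1 → |hess g z e e - hess g c e e| ≤ ‖hess g z - hess g c‖ := by
      intro e he
      have := (hess g z - hess g c).le_opNorm₂ e e
      simpa [he] using this
    have h2 := h1 1 (by simp)
    have h3 := h1 Complex.I (by simp)
    have h4 : 8 * M * dist z c ≤ 8 * M * r := by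
      have : 0 ≤ M := (absD_nonneg 3 g c).trans (hM c hc)
      gcongr
      exact dist_center_le hd hz
    rw [abs_le] at h2 h3
    rw [laplacian_eq_hess, laplacian_eq_hess, Real.norm_eq_abs, abs_le]
    constructor <;> linarith
  · rw [Measure.real, hvol, ENNReal.toReal_ofReal (by positivity)]
    apply le_of_eq; ring

end Derivatives

end

/-! ### Conclusion: the Taylor field at the centre of the square. -/

theorem mainTheorem8 :
    ∃ C : ℝ → ℝ, (∀ e, 0 < C e) ∧
      ∀ (Q : QuadLattice) (B : Finset ℂ), Q.IsColorClass B →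
      ∀ (c d : ℂ) (r : ℝ), ‖d‖ = 1 → Q.h < r → closedSquare c d r ⊆ Q.inside →
      ∀ g : ℂ → ℝ, ContDiff ℝ ∞ g →
        |(∑ᶠ z ∈ closedSquare c d r ∩ (B : Set ℂ), Q.laplacian g z) -
            ∫ z in closedSquare c d r, Laplacian.laplacian g z| ≤
          C Q.eccentricity *
            (Q.h * r * sSup (absD 2 g '' closedSquare c d r) +
              r ^ 3 * sSup (absD 3 g '' Metric.cthickening Q.h (closedSquare c d r))) := by
  -- The absolute value keeps the constant positive at every real `e`. The number 10000 exceeds the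
  -- collected coefficients, at most 8208 and 2064 times the fourth power.
  refine ⟨fun e => 10000 * (|e| + 1) ^ 4, fun e => by positivity, ?_⟩
  intro Q B hB c d r hd hr hin g hg
  have hh := Q.h_nonneg
  have hr0 : 0 < r := hh.trans_lt hr
  obtain ⟨hK, hD, hU⟩ := Q.cond_eccentricity
  set K := Q.eccentricity + 1
  set k := |Q.eccentricity| + 1 with hk
  have hKk : K ≤ k := add_le_add_left (le_abs_self _) 1
  have hk1 : 1 ≤ k := le_add_of_nonneg_left (abs_nonneg _)
  set R := closedSquare c d r with hR
  set S := Metric.cthickening Q.h R with hS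
  have hRS : R ⊆ S := Metric.self_subset_cthickening R
  have hRc : IsCompact R :=
    Metric.isCompact_of_isClosed_isBounded (isClosed_closedSquare c d r)
      ((Metric.isBounded_closedBall (x := c) (r := r)).subset fun z hz => dist_center_le hd hz)
  have hSc : IsCompact S := hRc.cthickening
  have hconv : Convex ℝ S := (convex_closedSquare c d r).cthickening _
  have hcR : c ∈ R := by simp [hR, closedSquare]; linarith
  have hM3 : ∀ x ∈ S, absD 3 g x ≤ sSup (absD 3 g '' S) := fun x hx => absD_le_sSup hg 3 hSc hx
  have hM2 : absD 2 g c ≤ sSup (absD 2 g '' R) := absD_le_sSup hg 2 hRc hcR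
  set M₃ := sSup (absD 3 g '' S)
  set M₂ := sSup (absD 2 g '' R)
  have hM30 : 0 ≤ M₃ := (absD_nonneg 3 g c).trans (hM3 c (hRS hcR))
  have hM20 : 0 ≤ M₂ := (absD_nonneg 2 g c).trans hM2
  -- A point of `S` is within `h < r` of the square, and the square is within `r` of its centre.
  have hdist : ∀ x ∈ S, dist x c ≤ 2 * r := by
    intro x hx
    rw [hS, hRc.cthickening_eq_biUnion_closedBall hh] at hx
    obtain ⟨y, hy, hxy⟩ := Set.mem_iUnion₂.1 hx
    have h1 : dist x y ≤ Q.h := hxy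
    have h2 := dist_center_le hd hy
    linarith [dist_triangle x y c]
  obtain ⟨e1, e2, e3⟩ := hess_entries_le g c
  have hmain := Q.abs_sum_laplacian_sub_le hB hd hr hin hD hU (m := 8 * M₃ * (2 * r) ^ 2)
    (by positivity) (e1.trans hM2) (e2.trans hM2) (e3.trans hM2)
    (hg.differentiable (by simp))
    (fun x hx => norm_fderiv_sub_taylorField_le hg hconv hM3 (hRS hcR) hx hdist)
  have hint := abs_integral_laplacian_sub_le hg hd hr0.le (fun x hx => hM3 x (hRS hx))
  refine (abs_sub_le _ _ _).trans ((add_le_add hmain hint).trans ?_)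
  have hK3 : K ^ 3 ≤ k ^ 4 :=
    (pow_le_pow_left₀ hK.le hKk 3).trans (pow_le_pow_right₀ hk1 (by norm_num))
  have hK4 : K ^ 4 ≤ k ^ 4 := pow_le_pow_left₀ hK.le hKk 4
  have hk4 : 1 ≤ k ^ 4 := one_le_pow₀ hk1
  have p1 : 0 ≤ Q.h * r * M₂ := by positivity
  have p2 : 0 ≤ r ^ 3 * M₃ := by positivity
  calc _ = (8192 * K ^ 4 + 16) * (r ^ 3 * M₃) +
        (1024 * K ^ 4 + 1024 * K ^ 3 + 16) * (Q.h * r * M₂) := by ring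
    _ ≤ 10000 * k ^ 4 * (r ^ 3 * M₃) + 10000 * k ^ 4 * (Q.h * r * M₂) := by
      gcongr <;> linarith
    _ = _ := by ring

end
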